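/- All graphs are finite. A looped simple graph $G$ is a simple graph in which, in addition, each vertex may carry a loop; two vertices are called adjacent (neighbors) only if they are distinct and joined by an edge. For $v\in V(G)$ let $G_\ell^v$ be obtained from $G$ by complementing the loop status of $v$; let $G_s^v$ be obtained by complementing the adjacency status of every pair of distinct neighbors of $v$; and let $G_{ns}^v$ be obtained from $G_s^v$ by also complementing the loop status of every neighbor of $v$. Looped simple graphs $G$ and $H$ are locally equivalent up to isomorphism if some graph obtained from $G$ by a finite (possibly empty) sequence of operations of these three kinds is isomorphic (as a looped graph) to $H$. Let $A(G)$ be the $V(G)\times V(G)$ adjacency matrix of $G$ over $GF(2)$, with diagonal entry $1$ exactly at looped vertices. The isotropic matroid $M[IAS(G)]$ is the binary matroid represented by the columns of $IAS(G)=\begin{pmatrix} I & A(G) & A(G)+I\end{pmatrix}$; its ground set $W(G)$ consists of the elements $\phi_G(v),\chi_G(v),\psi_G(v)$ ($v\in V(G)$), labeling the $v$ columns of $I$, $A(G)$ and $A(G)+I$ respectively. The set $\Phi(G)=\{\phi_G(v)\mid v\in V(G)\}$ is a basis of $M[IAS(G)]$. Let $B(G)$ be the fundamental graph of $M[IAS(G)]$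 with respect to $\Phi(G)$, that is, the bipartite simple graph with vertex set $W(G)$ in which $b\in\Phi(G)$ is joined to $w\notin\Phi(G)$ if and only if $b$ belongs to the unique circuit contained in $\Phi(G)\cup\{w\}$ (and there are no other edges). For an edge $vw$ of a simple graph $F$, the edge pivot is $F^{vw}=((F_s^v)_s^w)_s^v$. Simple graphs $F$ and $F'$ are pivot equivalent up to isomorphism if some graph obtained from $F$ by a finite (possibly empty) sequence of edge pivots is isomorphic to $F'$. Corollary. Two looped simple graphs $G$ and $H$ are locally equivalent up to isomorphism if and only if $B(G)$ and $B(H)$ are pivot equivalent up to isomorphism. -/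

import Mathlib

namespace IsotropicMatroid

/-- The simple local complement of a simple graph at a vertex `v`: the adjacency status of every
pair of (distinct) neighbors of `v` is complemented. -/
def simpleLocalComplement {V : Type*} (G : SimpleGraph V) (v : V) : SimpleGraph V where
  Adj x y := Xor (G.Adj x y) (x ≠ y ∧ G.Adj v x ∧ G.Adj v y)
  symm := ⟨fun x y h => by
    simpa only [G.adj_comm x y, ne_comm (a := x), and_comm (a := G.Adj v x)] using h⟩
  loopless := ⟨fun x h => by simp [Xor] at h⟩

/-- The edge pivot `((G_s^v)_s^w)_s^v` of a simple graph (used for an edge `vw`). -/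
def edgePivot {V : Type*} (G : SimpleGraph V) (v w : V) : SimpleGraph V :=
  simpleLocalComplement (simpleLocalComplement (simpleLocalComplement G v) w) v

/-- `H` can be obtained from `G` by a finite sequence of edge pivots at edges. -/
def PivotEquivalent {V : Type*} (G H : SimpleGraph V) : Prop :=
  Relation.ReflTransGen
    (fun G₁ G₂ : SimpleGraph V => ∃ v w, G₁.Adj v w ∧ G₂ = edgePivot G₁ v w) G H

/-- Pivot equivalence up to graph isomorphism. -/
def PivotEquivalentUpToIso {V W : Type*} (G : SimpleGraph V) (H : SimpleGraph W) : Prop :=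
  ∃ G' : SimpleGraph V, PivotEquivalent G G' ∧ Nonempty (G' ≃g H)

/-- A looped simple graph: a simple graph (adjacency relates distinct vertices only), in which
every vertex may in addition carry a loop. -/
structure LoopedGraph (V : Type*) extends SimpleGraph V where
  /-- the set of looped vertices -/
  loops : Set V

namespace LoopedGraph

variable {V W : Type*}

/-- `G_ℓ^v`: complement the loop status of `v`. -/
def loopComplement (G : LoopedGraph V) (v : V) : LoopedGraph V where
  toSimpleGraph := G.toSimpleGraph
  loops := symmDiff G.loops {v}

/-- `G_s^v`: complement the adjacency status of every pair of neighbors of `v`. -/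
def simpleComplement (G : LoopedGraph V) (v : V) : LoopedGraph V where
  toSimpleGraph := simpleLocalComplement G.toSimpleGraph v
  loops := G.loops

/-- `G_ns^v`: complement the adjacency status of every pair of neighbors of `v`, and the loop
status of every neighbor of `v`. -/
def nonsimpleComplement (G : LoopedGraph V) (v : V) : LoopedGraph V where
  toSimpleGraph := simpleLocalComplement G.toSimpleGraph v
  loops := symmDiff G.loops (G.toSimpleGraph.neighborSet v)

/-- `H` can be obtained from `G` by loop complementations and (simple or non-simple) local
complementations. -/
def LocallyEquivalent (G H : LoopedGraph V) : Prop :=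
  Relation.ReflTransGen
    (fun G₁ G₂ : LoopedGraph V => ∃ v, G₂ = G₁.loopComplement v ∨ G₂ = G₁.simpleComplement v ∨
      G₂ = G₁.nonsimpleComplement v) G H

/-- Isomorphism of looped simple graphs: a bijection of the vertices that preserves and reflects
adjacency and loops. -/
def IsIsomorphic (G : LoopedGraph V) (H : LoopedGraph W) : Prop :=
  ∃ e : G.toSimpleGraph ≃g H.toSimpleGraph, ∀ v, e v ∈ H.loops ↔ v ∈ G.loops

/-- Local equivalence up to graph isomorphism. -/
def LocallyEquivalentUpToIso (G : LoopedGraph V) (H : LoopedGraph W) : Prop :=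
  ∃ G' : LoopedGraph V, G.LocallyEquivalent G' ∧ G'.IsIsomorphic H

open Classical in
/-- The adjacency matrix over `GF(2)`; diagonal entries record loops. -/
noncomputable def adjacency (G : LoopedGraph V) : Matrix V V (ZMod 2) :=
  Matrix.of fun v w => if G.Adj v w ∨ (v = w ∧ v ∈ G.loops) then 1 else 0

open Classical in
/-- The matrix `IAS(G) = (I | A(G) | A(G) + I)`. The columns `Sum.inl v`, `Sum.inr (Sum.inl v)`,
`Sum.inr (Sum.inr v)` are `φ(v)`, `χ(v)`, `ψ(v)`. -/
noncomputable def IAS (G : LoopedGraph V) : Matrix V (V ⊕ V ⊕ V) (ZMod 2) :=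
  Matrix.fromCols 1 (Matrix.fromCols G.adjacency (G.adjacency + 1))

end LoopedGraph

/-- The matroid represented by the columns of a matrix over a field: a set of column indices is
independent iff the corresponding family of columns is linearly independent. -/
noncomputable def columnMatroid {X Y K : Type*} [Field K] [Finite Y] (A : Matrix X Y K) :
    Matroid Y :=
  (IndepMatroid.ofFinite (E := Set.univ) Set.finite_univ (fun I => LinearIndepOn K A.col I)
    (linearIndepOn_empty K A.col)
    (fun I J hJ hIJ => hJ.mono hIJ)
    (by
      intro I J hI hJ hlt
      by_contra! hcon
      have hsub : Submodule.span K (A.col '' J) ≤ Submodule.span K (A.col '' I) := by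
        rw [Submodule.span_le]
        rintro _ ⟨e, heJ, rfl⟩
        by_cases heI : e ∈ I
        · exact Submodule.subset_span ⟨e, heI, rfl⟩
        · by_contra hn
          exact hcon e heJ heI ((linearIndepOn_insert heI).2 ⟨hI, hn⟩)
      have hfin : Module.Finite K (Submodule.span K (A.col '' I)) :=
        Module.Finite.span_of_finite K (Set.toFinite _)
      have hle := Submodule.finrank_mono hsub
      have key : ∀ S : Set Y, LinearIndepOn K A.col S →
          Module.finrank K (Submodule.span K (A.col '' S)) = S.ncard := by
        intro S hS
        have := Fintype.ofFinite S
        have h := finrank_span_eq_card hS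
        rw [Set.ncard_eq_toFinset_card', Set.toFinset_card, ← h, ← Set.range_domRestrict]
        rfl
      rw [key I hI, key J hJ] at hle
      omega)
    (fun I _ => Set.subset_univ I)).matroid

/-- The fundamental graph of a matroid with respect to a basis `B`: its vertices are the elements
of the ground set, and its edges join `b ∈ B` to `w ∉ B` when `b` lies in the unique circuit
contained in `B ∪ {w}`. -/
def fundamentalGraph {α : Type*} (M : Matroid α) (B : Set α) (_hB : M.IsBase B) :
    SimpleGraph M.E where
  Adj x y := ((x : α) ∈ B ∧ (y : α) ∉ B ∧ (x : α) ∈ M.fundCircuit y B) ∨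
    ((y : α) ∈ B ∧ (x : α) ∉ B ∧ (y : α) ∈ M.fundCircuit x B)
  symm := ⟨fun _ _ h => h.symm⟩
  loopless := ⟨fun _ h => by tauto⟩

namespace LoopedGraph

/-- The isotropic matroid `M[IAS(G)]`. -/
noncomputable def isotropicMatroid {V : Type*} [Finite V] (G : LoopedGraph V) :
    Matroid (V ⊕ V ⊕ V) :=
  columnMatroid G.IAS

/-- `Φ(G)`, the set of all elements `φ(v)`. -/
def Phi (V : Type*) : Set (V ⊕ V ⊕ V) := Set.range Sum.inl

theorem isBase_Phi {V : Type*} [Finite V] (G : LoopedGraph V) :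
    G.isotropicMatroid.IsBase (Phi V) := by
  classical
  have := Fintype.ofFinite V
  have hcol : G.IAS.col ∘ Sum.inl = fun v : V => (Pi.single v 1 : V → ZMod 2) := by
    funext v w
    change (1 : Matrix V V (ZMod 2)) w v = _
    simp [Matrix.one_apply, Pi.single_apply]
  have hind : LinearIndependent (ZMod 2) (G.IAS.col ∘ (Sum.inl : V → V ⊕ V ⊕ V)) := by
    rw [hcol]
    exact Pi.linearIndependent_single_one V (ZMod 2)
  have hspan : Submodule.span (ZMod 2) (G.IAS.col '' Phi V) = ⊤ := by
    rw [Phi, ← Set.range_comp, hcol]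
    convert (Pi.basisFun (ZMod 2) V).span_eq using 3
    funext v
    simp
  refine ⟨linearIndepOn_range_iff Sum.inl_injective _ |>.2 hind, fun J hJ hPJ e heJ => ?_⟩
  by_contra heP
  have h := (linearIndepOn_insert heP).1 (hJ.mono (Set.insert_subset heJ hPJ))
  exact h.2 (hspan ▸ Submodule.mem_top)

/-- `B(G)`, the fundamental graph of `M[IAS(G)]` with respect to the basis `Φ(G)`. -/
noncomputable def fundamentalBipartite {V : Type*} [Finite V] (G : LoopedGraph V) :
    SimpleGraph G.isotropicMatroid.E :=
  fundamentalGraph G.isotropicMatroid (Phi V) G.isBase_Phi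

end LoopedGraph

end IsotropicMatroid

/-! Both sides are equivalent to one statement about the row space `L` of `IAS(G)`: some bijection
of the coordinates carries the space of `G` to that of `H`.

Pivots. A bipartite graph with colour class `B` encodes a binary space with basis `B`. An edge pivot
is a basis exchange: it preserves the space (`rowSpace_edgePivot`), and any two bases of one space
are linked by exchanges (`pivotEquivalent_of_rowSpace_eq`). A graph isomorphism may however swap the
colour classes of some components, which replaces the space there by its orthogonal complement.
Self-orthogonality of both spaces forces the two to coincide (`rowSpace_eq_of_isSelfOrthogonal`).

Triples. Vectors of `L` have even weight on each triple φ(v), χ(v), ψ(v), and `L` is maximal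
isotropic for the symplectic form that this induces. A coordinate bijection need not respect
triples, but two triple systems on the same `L` always differ by an automorphism of `L`
(`exists_preserves_fibers_eq`): either two triples share exactly two elements and a transposition
brings them together, or there is a 4 × 4 crossing pattern whose transpose preserves `L`.

Local equivalence. What remains is a bijection of vertices and a permutation inside each triple.
Loop complementation exchanges χ(v) and ψ(v); non-simple complementation at a looped `v` exchanges
φ(v) and χ(v). Conversely, any family of permutations relating two isotropic spaces can be undone by
such moves (`TwistedBy.locallyEquivalent`). -/

namespace IsotropicMatroid

/-! ### Edge pivots over GF(2) -/

section Pivot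

open Classical in
/-- Adjacency in a simple graph as an element of `GF(2)`. -/
noncomputable def adj {α : Type*} (F : SimpleGraph α) (x y : α) : ZMod 2 :=
  if F.Adj x y then 1 else 0

variable {α β : Type*}

theorem adj_congr {F : SimpleGraph α} {F' : SimpleGraph β} {x y : α} {z w : β}
    (h : F.Adj x y ↔ F'.Adj z w) : adj F x y = adj F' z w := by
  unfold adj
  split_ifs <;> tauto

theorem adj_comm (F : SimpleGraph α) (x y : α) : adj F x y = adj F y x := 
  adj_congr (F.adj_comm x y)

@[simp] theorem adj_self (F : SimpleGraph α) (x : α) : adj F x x = 0 := by simp [adj]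

theorem adj_eq_one {F : SimpleGraph α} {x y : α} : adj F x y = 1 ↔ F.Adj x y := by simp [adj]

theorem adj_eq_zero {F : SimpleGraph α} {x y : α} : adj F x y = 0 ↔ ¬F.Adj x y := by simp [adj]

theorem zmod_two_eq_zero_or_one (a : ZMod 2) : a = 0 ∨ a = 1 := by
  revert a; decide

theorem zmod_two_add_self (a : ZMod 2) : a + a = 0 := by
  revert a; decide

open Classical in
theorem adj_simpleLocalComplement (F : SimpleGraph α) (v x y : α) :
    adj (simpleLocalComplement F v) x y =
      adj F x y + (if x = y then 0 else adj F v x * adj F v y) := by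
  by_cases hxy : x = y
  · subst hxy; simp
  · have : (simpleLocalComplement F v).Adj x y ↔ Xor (F.Adj x y) (F.Adj v x ∧ F.Adj v y) := by
      simp [simpleLocalComplement, hxy]
    simp only [adj, this, hxy, if_false]
    by_cases h1 : F.Adj x y <;> by_cases h2 : F.Adj v x <;> by_cases h3 : F.Adj v y <;>
      simp [h1, h2, h3, Xor] <;> decide

theorem adj_edgePivot_left_right {F : SimpleGraph α} {v w : α} (h : F.Adj v w) :
    adj (edgePivot F v w) v w = 1 := by
  have hne := h.ne
  have h' := adj_eq_one.2 h
  simp [edgePivot, adj_simpleLocalComplement, hne, hne.symm, adj_comm F w v, h']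

theorem adj_edgePivot_left {F : SimpleGraph α} {v w y : α} (h : F.Adj v w) (hv : y ≠ v)
    (hw : y ≠ w) : adj (edgePivot F v w) v y = adj F w y := by
  have hne := h.ne
  have h' := adj_eq_one.2 h
  simp only [edgePivot, adj_simpleLocalComplement, hne.symm, hv.symm, hw.symm, adj_comm F w v,
    h', adj_self, if_false]
  generalize adj F v y = a
  generalize adj F w y = b
  revert a b; decide

theorem adj_edgePivot_right {F : SimpleGraph α} {v w y : α} (h : F.Adj v w) (hv : y ≠ v)
    (hw : y ≠ w) : adj (edgePivot F v w) w y = adj F v y := by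
  have hne := h.ne
  have h' := adj_eq_one.2 h
  simp only [edgePivot, adj_simpleLocalComplement, hne, hne.symm, hv.symm, hw.symm, adj_comm F w v,
    h', adj_self, if_false]
  generalize adj F v y = a
  generalize adj F w y = b
  revert a b; decide

theorem adj_edgePivot_of_ne {F : SimpleGraph α} {v w x y : α} (h : F.Adj v w) (hxv : x ≠ v)
    (hxw : x ≠ w) (hyv : y ≠ v) (hyw : y ≠ w) :
    adj (edgePivot F v w) x y =
      adj F x y + adj F v x * adj F w y + adj F w x * adj F v y := by
  have hne := h.ne
  have h' := adj_eq_one.2 h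
  by_cases hxy : x = y
  · subst hxy
    simp only [adj_self]
    generalize adj F v x = a
    generalize adj F w x = b
    revert a b; decide
  simp only [edgePivot, adj_simpleLocalComplement, hne.symm, hyv.symm, hyw.symm,
    hxv.symm, hxw.symm, adj_comm F w v, h', adj_self, if_false, hxy]
  generalize adj F v y = a
  generalize adj F w y = b
  generalize adj F v x = c
  generalize adj F w x = d
  generalize adj F x y = e
  revert a b c d e; decide

theorem ext_adj {F F' : SimpleGraph α} (h : ∀ x y, adj F x y = adj F' x y) : F = F' := by
  ext x y
  rw [← adj_eq_one, ← adj_eq_one, h]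

theorem edgePivot_comm {F : SimpleGraph α} {v w : α} (h : F.Adj v w) :
    edgePivot F v w = edgePivot F w v := by
  refine ext_adj fun x y => ?_
  have key : ∀ y, adj (edgePivot F v w) v y = adj (edgePivot F w v) v y := fun y => by
    by_cases hyv : y = v
    · subst hyv; simp
    by_cases hyw : y = w
    · subst hyw
      rw [adj_edgePivot_left_right h, adj_comm, adj_edgePivot_left_right h.symm]
    rw [adj_edgePivot_left h hyv hyw, adj_edgePivot_right h.symm hyw hyv]
  have key' : ∀ y, adj (edgePivot F v w) w y = adj (edgePivot F w v) w y := fun y => by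
    by_cases hyv : y = v
    · subst hyv
      rw [adj_comm, adj_edgePivot_left_right h, adj_edgePivot_left_right h.symm]
    by_cases hyw : y = w
    · subst hyw; simp
    rw [adj_edgePivot_right h hyv hyw, adj_edgePivot_left h.symm hyw hyv]
  by_cases hxv : x = v
  · rw [hxv, key]
  by_cases hxw : x = w
  · rw [hxw, key']
  by_cases hyv : y = v
  · rw [hyv, adj_comm, key, adj_comm]
  by_cases hyw : y = w
  · rw [hyw, adj_comm, key', adj_comm]
  rw [adj_edgePivot_of_ne h hxv hxw hyv hyw, adj_edgePivot_of_ne h.symm hxw hxv hyw hyv]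
  ring

/-- Every edge of `F` has exactly one end in `B`. -/
def IsBipartition (F : SimpleGraph α) (B : Set α) : Prop :=
  ∀ ⦃x y⦄, F.Adj x y → (x ∈ B ↔ y ∉ B)

theorem IsBipartition.adj_eq_zero {F : SimpleGraph α} {B : Set α} (h : IsBipartition F B)
    {x y : α} (hxy : x ∈ B ↔ y ∈ B) : adj F x y = 0 := by
  rw [IsotropicMatroid.adj_eq_zero]
  intro ha
  have := h ha
  tauto

theorem IsBipartition.edgePivot {F : SimpleGraph α} {B : Set α} (h : IsBipartition F B)
    {v w : α} (ha : F.Adj v w) (hv : v ∈ B) (hw : w ∉ B) :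
    IsBipartition (edgePivot F v w) (symmDiff B {v, w}) := by
  have key : ∀ y, y ≠ v → y ≠ w → (y ∈ symmDiff B {v, w} ↔ y ∈ B) := fun y h1 h2 => by
    simp [Set.mem_symmDiff, h1, h2]
  have kv : v ∉ symmDiff B {v, w} := by simp [Set.mem_symmDiff, hv]
  have kw : w ∈ symmDiff B {v, w} := by simp [Set.mem_symmDiff, hw]
  have main : ∀ x y, x ∈ symmDiff B {v, w} → y ∈ symmDiff B {v, w} →
      adj (IsotropicMatroid.edgePivot F v w) x y = 0 := by
    intro x y hx hy
    have hxv : x ≠ v := fun h => kv (h ▸ hx)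
    have hyv : y ≠ v := fun h => kv (h ▸ hy)
    by_cases hxw : x = w <;> by_cases hyw : y = w
    · subst hxw hyw; simp
    · subst hxw
      rw [adj_edgePivot_right ha hyv hyw, h.adj_eq_zero]
      rw [key y hyv hyw] at hy; tauto
    · subst hyw
      rw [adj_comm, adj_edgePivot_right ha hxv hxw, h.adj_eq_zero]
      rw [key x hxv hxw] at hx; tauto
    · rw [key _ hxv hxw] at hx
      rw [key _ hyv hyw] at hy
      rw [adj_edgePivot_of_ne ha hxv hxw hyv hyw, h.adj_eq_zero (x := x) (y := y) (by tauto),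
        h.adj_eq_zero (x := v) (y := x) (by tauto), h.adj_eq_zero (x := v) (y := y) (by tauto)]
      ring
  have main' : ∀ x y, x ∉ symmDiff B {v, w} → y ∉ symmDiff B {v, w} →
      adj (IsotropicMatroid.edgePivot F v w) x y = 0 := by
    intro x y hx hy
    have hxw : x ≠ w := fun h => hx (h ▸ kw)
    have hyw : y ≠ w := fun h => hy (h ▸ kw)
    by_cases hxv : x = v <;> by_cases hyv : y = v
    · subst hxv hyv; simp
    · subst hxv
      rw [adj_edgePivot_left ha hyv hyw, h.adj_eq_zero]
      rw [key y hyv hyw] at hy; tauto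
    · subst hyv
      rw [adj_comm, adj_edgePivot_left ha hxv hxw, h.adj_eq_zero]
      rw [key x hxv hxw] at hx; tauto
    · rw [key _ hxv hxw] at hx
      rw [key _ hyv hyw] at hy
      rw [adj_edgePivot_of_ne ha hxv hxw hyv hyw, h.adj_eq_zero (x := x) (y := y) (by tauto),
        h.adj_eq_zero (x := w) (y := x) (by tauto), h.adj_eq_zero (x := w) (y := y) (by tauto)]
      ring
  intro x y hxy
  rw [← adj_eq_one] at hxy
  have h1 := main x y
  have h2 := main' x y
  rw [hxy] at h1 h2
  simp only [one_ne_zero, imp_false] at h1 h2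
  exact ⟨h1, fun hy => by by_contra hx; exact h2 hx hy⟩

open Classical in
/-- The row of the standard representation indexed by `b`. -/
noncomputable def graphRow (F : SimpleGraph α) (b : α) : α → ZMod 2 :=
  fun y => adj F b y + if y = b then 1 else 0

theorem graphRow_self (F : SimpleGraph α) (b : α) : graphRow F b b = 1 := by simp [graphRow]

theorem graphRow_of_ne {F : SimpleGraph α} {b y : α} (h : y ≠ b) :
    graphRow F b y = adj F b y := by simp [graphRow, h]

theorem IsBipartition.graphRow_eq_zero {F : SimpleGraph α} {B : Set α} (h : IsBipartition F B)
    {b y : α} (hb : b ∈ B) (hy : y ∈ B) (hne : y ≠ b) : graphRow F b y = 0 := by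
  rw [graphRow_of_ne hne, h.adj_eq_zero (by tauto)]

theorem IsBipartition.comap {F : SimpleGraph α} {F' : SimpleGraph β} (e : F ≃g F') {B : Set β}
    (h : IsBipartition F' B) : IsBipartition F (e ⁻¹' B) := fun x y hxy => by
  have := h (e.map_adj_iff.2 hxy)
  simpa using this

/-! ### Binary spaces of bipartite graphs and basis exchange -/

variable [Fintype α] [Fintype β]

/-- The binary space with fundamental graph `F` with respect to the basis `B`. -/
noncomputable def rowSpace (F : SimpleGraph α) (B : Set α) : Submodule (ZMod 2) (α → ZMod 2) where
  carrier := {x | ∀ y ∉ B, x y = ∑ b, adj F b y * x b}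
  add_mem' := fun {x z} hx hz y hy => by
    simp only [Pi.add_apply, mul_add, Finset.sum_add_distrib, hx y hy, hz y hy]
  zero_mem' := fun y _ => by simp
  smul_mem' := fun c x hx y hy => by
    simp only [Pi.smul_apply, smul_eq_mul, hx y hy, Finset.mul_sum]
    exact Finset.sum_congr rfl fun _ _ => by ring

theorem mem_rowSpace {F : SimpleGraph α} {B : Set α} {x : α → ZMod 2} :
    x ∈ rowSpace F B ↔ ∀ y ∉ B, x y = ∑ b, adj F b y * x b := Iff.rfl

theorem IsBipartition.graphRow_mem {F : SimpleGraph α} {B : Set α} (h : IsBipartition F B)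
    {b : α} (hb : b ∈ B) : graphRow F b ∈ rowSpace F B := by
  intro y hy
  have hne : y ≠ b := fun e => hy (e ▸ hb)
  rw [graphRow_of_ne hne, Finset.sum_eq_single b]
  · simp [graphRow_self]
  · intro c _ hc
    by_cases hcB : c ∈ B
    · rw [h.graphRow_eq_zero hb hcB hc, mul_zero]
    · rw [h.adj_eq_zero (x := c) (y := y) (by tauto), zero_mul]
  · simp

/-- Gaussian elimination: the new equation at `v` is the old equation at `w`, and every other new
equation differs from the old one at `y` by `adj F v y` times the equation at `w`. -/
theorem rowSpace_edgePivot {F : SimpleGraph α} {B : Set α} (h : IsBipartition F B)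
    {v w : α} (ha : F.Adj v w) (hv : v ∈ B) (hw : w ∉ B) :
    rowSpace (edgePivot F v w) (symmDiff B {v, w}) = rowSpace F B := by
  classical
  have kv : v ∉ symmDiff B {v, w} := by simp [Set.mem_symmDiff, hv]
  have kw : w ∈ symmDiff B {v, w} := by simp [Set.mem_symmDiff, hw]
  have ha' := adj_eq_one.2 ha
  have e1 : ∀ b, adj (edgePivot F v w) b v =
      adj F b w + (if b = v then 1 else 0) + (if b = w then 1 else 0) := by
    intro b
    by_cases hbv : b = v
    · subst hbv; simp [ha', ha.ne]; decide
    by_cases hbw : b = w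
    · subst hbw; simp [hbv, adj_comm _ b v, adj_edgePivot_left_right ha]
    rw [adj_comm, adj_edgePivot_left ha hbv hbw]; simp [hbv, hbw, adj_comm]
  have e2 : ∀ y, y ∉ B → y ≠ w → ∀ b, adj (edgePivot F v w) b y =
      adj F b y + adj F v y * (adj F b w + if b = w then 1 else 0) := by
    intro y hy hyw b
    have hyv : y ≠ v := fun e => hy (e ▸ hv)
    have hwy : adj F w y = 0 := h.adj_eq_zero (by tauto)
    by_cases hbv : b = v
    · subst hbv; simp [ha', ha.ne, adj_edgePivot_left ha hyv hyw, hwy, zmod_two_add_self]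
    by_cases hbw : b = w
    · subst hbw; simp [hwy, adj_edgePivot_right ha hyv hyw]
    rw [adj_edgePivot_of_ne ha hbv hbw hyv hyw, hwy]
    simp only [hbw, if_false, adj_comm F b w]
    ring
  have s1 : ∀ x : α → ZMod 2, ∑ b, adj (edgePivot F v w) b v * x b =
      ∑ b, adj F b w * x b + x v + x w := by
    intro x
    simp only [e1, add_mul, Finset.sum_add_distrib]
    simp
  have s2 : ∀ y, y ∉ B → y ≠ w → ∀ x : α → ZMod 2, ∑ b, adj (edgePivot F v w) b y * x b =
      ∑ b, adj F b y * x b + adj F v y * (∑ b, adj F b w * x b + x w) := by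
    intro y hy hyw x
    have : x w = ∑ b, (if b = w then 1 else 0) * x b := by simp
    rw [this, ← Finset.sum_add_distrib, Finset.mul_sum, ← Finset.sum_add_distrib]
    refine Finset.sum_congr rfl fun b _ => ?_
    rw [e2 y hy hyw b]
    ring
  ext x
  simp only [mem_rowSpace]
  constructor
  · intro hx
    have h1 : x w = ∑ b, adj F b w * x b := by
      have := hx v kv
      rw [s1] at this
      generalize x w = a at *
      generalize x v = b at *
      generalize ∑ b, adj F b w * x b = c at *
      revert a b c; decide
    intro y hy
    by_cases hyw : y = w
    · rw [hyw, h1]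
    have hyv : y ≠ v := fun e => hy (e ▸ hv)
    have := hx y (by simp [Set.mem_symmDiff, hyw, hyv, hy])
    rwa [s2 y hy hyw, ← h1, zmod_two_add_self, mul_zero, add_zero] at this
  · intro hx y hy
    by_cases hyv : y = v
    · rw [hyv, s1, ← hx w hw]
      generalize x w = a at *
      generalize x v = b at *
      revert a b; decide
    have hyw : y ≠ w := fun e => hy (e ▸ kw)
    have hyB : y ∉ B := fun hB => hy (by simp [Set.mem_symmDiff, hyw, hyv, hB])
    rw [s2 y hyB hyw, ← hx w hw, zmod_two_add_self, mul_zero, add_zero, hx y hyB]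

theorem PivotEquivalent.exists_rowSpace_eq {F F' : SimpleGraph α} {B : Set α}
    (hF : IsBipartition F B) (h : PivotEquivalent F F') :
    ∃ B', IsBipartition F' B' ∧ rowSpace F' B' = rowSpace F B := by
  induction h with
  | refl => exact ⟨B, hF, rfl⟩
  | tail _ h ih =>
    obtain ⟨C, hC, hCB⟩ := ih
    obtain ⟨v, w, ha, rfl⟩ := h
    by_cases hv : v ∈ C
    · have hw := (hC ha).1 hv
      exact ⟨_, hC.edgePivot ha hv hw, by rw [rowSpace_edgePivot hC ha hv hw, hCB]⟩
    · have hw : w ∈ C := by have := hC ha; tauto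
      rw [edgePivot_comm ha]
      exact ⟨_, hC.edgePivot ha.symm hw hv, by rw [rowSpace_edgePivot hC ha.symm hw hv, hCB]⟩

theorem eq_of_rowSpace_eq {F F' : SimpleGraph α} {B : Set α} (hF : IsBipartition F B)
    (hF' : IsBipartition F' B) (h : rowSpace F B = rowSpace F' B) : F = F' := by
  have main : ∀ x y, x ∈ B → y ∉ B → adj F x y = adj F' x y := by
    intro x y hx hy
    have hne : y ≠ x := fun e => hy (e ▸ hx)
    have h1 := hF.graphRow_mem hx
    rw [h] at h1
    have h2 := h1 y hy
    rw [graphRow_of_ne hne, Finset.sum_eq_single x] at h2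
    · simpa [graphRow_self] using h2
    · intro c _ hc
      by_cases hcB : c ∈ B
      · rw [hF.graphRow_eq_zero hx hcB hc, mul_zero]
      · rw [hF'.adj_eq_zero (x := c) (y := y) (by tauto), zero_mul]
    · simp
  refine ext_adj fun x y => ?_
  by_cases hx : x ∈ B <;> by_cases hy : y ∈ B
  · rw [hF.adj_eq_zero (by tauto), hF'.adj_eq_zero (by tauto)]
  · exact main x y hx hy
  · rw [adj_comm, main y x hy hx, adj_comm]
  · rw [hF.adj_eq_zero (by tauto), hF'.adj_eq_zero (by tauto)]

theorem IsBipartition.eq_zero_of_forall_mem {F : SimpleGraph α} {B : Set α}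
    (hF : IsBipartition F B) {x : α → ZMod 2} (hx : x ∈ rowSpace F B) (h : ∀ b ∈ B, x b = 0) :
    x = 0 := by
  funext y
  by_cases hy : y ∈ B
  · exact h y hy
  rw [hx y hy]
  refine Finset.sum_eq_zero fun b _ => ?_
  by_cases hb : b ∈ B
  · rw [h b hb, mul_zero]
  · rw [hF.adj_eq_zero (by tauto), zero_mul]

/-- Basis exchange: a pivot at an edge `vw` with `w ∈ B' \ B` and `v ∈ B \ B'` brings `B` one
element closer to `B'`. -/
theorem pivotEquivalent_of_rowSpace_eq {F' : SimpleGraph α} {B' : Set α}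
    (hF' : IsBipartition F' B') (n : ℕ) : ∀ {F : SimpleGraph α} {B : Set α},
    IsBipartition F B → rowSpace F B = rowSpace F' B' → (B' \ B).ncard = n →
    PivotEquivalent F F' := by
  induction n with
  | zero =>
    intro F B hF h hn
    have hsub : B' ⊆ B := by
      rwa [Set.ncard_eq_zero, Set.sdiff_eq_empty] at hn
    have : B = B' := by
      refine Set.Subset.antisymm (fun b hb => ?_) hsub
      -- The row of `b ∈ B \ B'` vanishes on the basis `B'`, hence everywhere, yet it is 1 at `b`.
      by_contra hb'
      have h1 := hF.graphRow_mem hb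
      rw [h] at h1
      have h2 := hF'.eq_zero_of_forall_mem h1 fun c hc =>
        hF.graphRow_eq_zero hb (hsub hc) fun e => hb' (e ▸ hc)
      have := congrFun h2 b
      simp [graphRow_self] at this
    subst this
    rw [eq_of_rowSpace_eq hF hF' h]
    exact Relation.ReflTransGen.refl
  | succ n ih =>
    intro F B hF h hn
    obtain ⟨w, hw', hw⟩ : (B' \ B).Nonempty := by
      rw [← Set.ncard_pos]; omega
    obtain ⟨v, hv, hv', ha⟩ : ∃ v, v ∈ B ∧ v ∉ B' ∧ F.Adj v w := by
      -- Otherwise the `F`-equation at `w`, applied to the `F'`-row of `w`, reads 1 = 0: the row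
      -- vanishes on `B ∩ B'`, and no edge joins `w` to `B \ B'`.
      by_contra! hcon
      have h1 := hF'.graphRow_mem hw'
      have h2 := h1
      rw [← h] at h2
      have h3 := h2 w hw
      rw [graphRow_self, Finset.sum_eq_zero] at h3
      · exact one_ne_zero h3
      intro b _
      by_cases hb : b ∈ B
      · by_cases hb' : b ∈ B'
        · rw [hF'.graphRow_eq_zero hw' hb' fun e => hw (e ▸ hb), mul_zero]
        · rw [adj_eq_zero.2 (hcon b hb hb'), zero_mul]
      · rw [hF.adj_eq_zero (by tauto), zero_mul]
    have hstep : ∃ v' w', F.Adj v' w' ∧ edgePivot F v w = edgePivot F v' w' := ⟨v, w, ha, rfl⟩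
    refine Relation.ReflTransGen.head hstep
      (ih (hF.edgePivot ha hv hw) ((rowSpace_edgePivot hF ha hv hw).trans h) ?_)
    have : B' \ symmDiff B {v, w} = (B' \ B) \ {w} := by
      ext x
      simp only [Set.mem_sdiff, Set.mem_symmDiff, Set.mem_insert_iff, Set.mem_singleton_iff]
      by_cases hxv : x = v
      · subst hxv; tauto
      by_cases hxw : x = w
      · subst hxw; tauto
      tauto
    rw [this, Set.ncard_sdiff_singleton_of_mem (show w ∈ B' \ B from ⟨hw', hw⟩), hn]
    rfl

/-! ### Independence of the choice of colour classes -/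

/-- Any two vectors of the space are orthogonal. -/
def IsSelfOrthogonal (L : Submodule (ZMod 2) (α → ZMod 2)) : Prop :=
  ∀ x ∈ L, ∀ y ∈ L, ∑ a, x a * y a = 0

/-- Self-orthogonality of (I | A) means A Aᵀ = I. This is the equation that the row of `b ∈ B \ C`
must satisfy at the points of `B \ C`; at points outside both classes only the term at `b` survives.
-/
theorem rowSpace_le_of_isSelfOrthogonal {F : SimpleGraph α} {B C : Set α}
    (hB : IsBipartition F B) (hC : IsBipartition F C) (h : IsSelfOrthogonal (rowSpace F B)) :
    rowSpace F B ≤ rowSpace F C := by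
  classical
  have hrow : ∀ b ∈ B, graphRow F b ∈ rowSpace F C := by
    intro b hb
    by_cases hbC : b ∈ C
    · exact hC.graphRow_mem hbC
    intro y hy
    have key : ∑ c, adj F c y * graphRow F b c = ∑ c, adj F y c * adj F b c + adj F b y := by
      simp only [graphRow, mul_add, Finset.sum_add_distrib, adj_comm F y]
      simp
    by_cases hyB : y ∈ B
    · have h1 := h _ (hB.graphRow_mem hyB) _ (hB.graphRow_mem hb)
      have h2 : ∑ a, graphRow F y a * graphRow F b a =
          ∑ c, adj F y c * adj F b c + (if y = b then 1 else 0) + adj F b y + adj F y b := by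
        simp only [graphRow, mul_add, add_mul, Finset.sum_add_distrib]
        simp only [mul_ite, mul_one, mul_zero, Finset.sum_ite_eq',
          Finset.mem_univ, if_true, eq_comm (a := y) (b := b)]
        simp
        ring
      rw [key, hB.adj_eq_zero (x := b) (y := y) (by tauto)]
      rw [h2, hB.adj_eq_zero (x := b) (y := y) (by tauto),
        hB.adj_eq_zero (x := y) (y := b) (by tauto)] at h1
      rw [graphRow, hB.adj_eq_zero (x := b) (y := y) (by tauto)]
      generalize ∑ c, adj F y c * adj F b c = s at h1 ⊢
      clear key h2
      by_cases e : y = b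
      · simp only [e, if_true] at h1 ⊢; revert h1; revert s; decide
      · simp only [e, if_false] at h1 ⊢; revert h1; revert s; decide
    · rw [key, Finset.sum_eq_zero, zero_add, graphRow_of_ne fun e : y = b => hyB (e ▸ hb)]
      intro c _
      by_cases hc : c ∈ B
      · rw [hB.adj_eq_zero (x := b) (y := c) (by tauto), mul_zero]
      · rw [hB.adj_eq_zero (x := y) (y := c) (by tauto), zero_mul]
  intro x hx
  have hx' : x = ∑ b, (if b ∈ B then x b else 0) • graphRow F b := by
    rw [← sub_eq_zero]
    refine hB.eq_zero_of_forall_mem (sub_mem hx (sum_mem fun b _ => ?_)) fun c hc => ?_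
    · by_cases hb : b ∈ B
      · exact Submodule.smul_mem _ _ (hB.graphRow_mem hb)
      · simp [hb]
    · rw [Pi.sub_apply, Finset.sum_apply, Finset.sum_eq_single c]
      · simp [hc, graphRow_self]
      · intro b _ hbc
        by_cases hb : b ∈ B
        · simp [hB.graphRow_eq_zero hb hc hbc.symm]
        · simp [hb]
      · simp
  rw [hx']
  refine sum_mem fun b _ => ?_
  by_cases hb : b ∈ B
  · exact Submodule.smul_mem _ _ (hrow b hb)
  · simp [hb]

theorem rowSpace_eq_of_isSelfOrthogonal {F : SimpleGraph α} {B C : Set α}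
    (hB : IsBipartition F B) (hC : IsBipartition F C) (h : IsSelfOrthogonal (rowSpace F B))
    (h' : IsSelfOrthogonal (rowSpace F C)) : rowSpace F B = rowSpace F C :=
  le_antisymm (rowSpace_le_of_isSelfOrthogonal hB hC h) (rowSpace_le_of_isSelfOrthogonal hC hB h')

theorem mem_rowSpace_comap {F : SimpleGraph α} {F' : SimpleGraph β} (e : F ≃g F') {B : Set β}
    {x : β → ZMod 2} : x ∘ e ∈ rowSpace F (e ⁻¹' B) ↔ x ∈ rowSpace F' B := by
  have key : ∀ y, ∑ b, adj F b y * (x ∘ e) b = ∑ b, adj F' b (e y) * x b := by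
    intro y
    refine Fintype.sum_equiv e.toEquiv _ _ fun b => ?_
    rw [adj_congr (e.map_adj_iff (v := b) (w := y)).symm]; rfl
  simp only [mem_rowSpace, key]
  constructor
  · intro h y hy
    have := h (e.symm y) (by simpa using hy)
    simpa using this
  · intro h y hy
    exact h (e y) hy

/-- A bijection of the coordinates carries one space to the other. -/
def Equivalent (L : Submodule (ZMod 2) (α → ZMod 2)) (L' : Submodule (ZMod 2) (β → ZMod 2)) :
    Prop :=
  ∃ f : α ≃ β, ∀ x : β → ZMod 2, x ∘ f ∈ L ↔ x ∈ L'

theorem Equivalent.pivotEquivalentUpToIso {F : SimpleGraph α} {F' : SimpleGraph β} {B : Set α}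
    {B' : Set β} (hF : IsBipartition F B) (hF' : IsBipartition F' B')
    (h : Equivalent (rowSpace F B) (rowSpace F' B')) : PivotEquivalentUpToIso F F' := by
  obtain ⟨f, hf⟩ := h
  let e : F'.comap f ≃g F' := SimpleGraph.Iso.comap f F'
  refine ⟨F'.comap f, pivotEquivalent_of_rowSpace_eq (hF'.comap e) _ hF ?_ rfl, ⟨e⟩⟩
  ext x
  have h1 := hf (x ∘ f.symm)
  have h2 := mem_rowSpace_comap e (B := B') (x := x ∘ f.symm)
  have h3 : (x ∘ f.symm) ∘ f = x := by ext; simp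
  have h4 : (x ∘ f.symm) ∘ e = x := h3
  rw [h3] at h1
  rw [h4] at h2
  rw [h1, h2]

theorem PivotEquivalentUpToIso.equivalent {F : SimpleGraph α} {F' : SimpleGraph β} {B : Set α}
    {B' : Set β} (hF : IsBipartition F B) (hF' : IsBipartition F' B')
    (hs : IsSelfOrthogonal (rowSpace F B)) (hs' : IsSelfOrthogonal (rowSpace F' B'))
    (h : PivotEquivalentUpToIso F F') : Equivalent (rowSpace F B) (rowSpace F' B') := by
  obtain ⟨F₁, h, ⟨e⟩⟩ := h
  obtain ⟨C, hC, hCB⟩ := h.exists_rowSpace_eq hF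
  have hs₁ : IsSelfOrthogonal (rowSpace F₁ (e ⁻¹' B')) := by
    intro x hx y hy
    have hx' := (mem_rowSpace_comap e (B := B') (x := x ∘ e.symm)).1 (by
      convert hx using 1; ext; simp)
    have hy' := (mem_rowSpace_comap e (B := B') (x := y ∘ e.symm)).1 (by
      convert hy using 1; ext; simp)
    rw [← hs' _ hx' _ hy']
    exact Fintype.sum_equiv e.toEquiv _ _ fun b => by simp
  refine ⟨e.toEquiv, fun x => ?_⟩
  -- `C`, obtained by following the pivots, and `e ⁻¹' B'` are both bipartitions of `F₁` and may
  -- differ on some components.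
  rw [← hCB, rowSpace_eq_of_isSelfOrthogonal hC (hF'.comap e) (hCB ▸ hs) hs₁]
  exact mem_rowSpace_comap e

end Pivot

/-! ### Two triple systems on one space -/

section Triples

variable {α V W : Type*}

open Classical in
/-- The fibers of `p` partition the coordinates of `L` into triples, on each of which every vector
of `L` has even weight, and which together with `L` span the orthogonal complement of `L` (only the
consequence for transversal triples is recorded). -/
structure IsTripleSystem (p : α → V) (L : Submodule (ZMod 2) (α → ZMod 2)) : Prop where
  exists_fiber : ∀ a, ∃ b c, b ≠ a ∧ c ≠ a ∧ b ≠ c ∧ ∀ x, p x = p a ↔ x = a ∨ x = b ∨ x = c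
  even : ∀ x ∈ L, ∀ a b c, a ≠ b → a ≠ c → b ≠ c → p b = p a → p c = p a → x a + x b + x c = 0
  dual : ∀ a b c, p a ≠ p b → p a ≠ p c → p b ≠ p c → (∀ x ∈ L, x a + x b + x c = 0) →
    (fun y => if (p y = p a ∨ p y = p b ∨ p y = p c) ∧ y ≠ a ∧ y ≠ b ∧ y ≠ c then (1 : ZMod 2)
      else 0) ∈ L

/-- The permutation `σ` of the coordinates preserves `L`. -/
def Preserves (σ : Equiv.Perm α) (L : Submodule (ZMod 2) (α → ZMod 2)) : Prop :=
  ∀ x : α → ZMod 2, x ∘ σ ∈ L ↔ x ∈ L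

/-- The fibers of `p` and `q` through `a` agree. -/
def FibersAgree (p : α → V) (q : α → W) (a : α) : Prop := ∀ b, p b = p a ↔ q b = q a

variable {p : α → V} {q : α → W} {L : Submodule (ZMod 2) (α → ZMod 2)}

theorem preserves_of_involutive {σ : Equiv.Perm α} (hσ : Function.Involutive σ)
    (h : ∀ x ∈ L, x ∘ σ ∈ L) : Preserves σ L := fun x => by
  refine ⟨fun hx => ?_, h x⟩
  have := h _ hx
  rwa [Function.comp_assoc, hσ.comp_self] at this

theorem IsTripleSystem.comp_equiv {β : Type*} {p : β → V}
    {L' : Submodule (ZMod 2) (β → ZMod 2)} (hp : IsTripleSystem p L') (f : α ≃ β)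
    (hf : ∀ x : β → ZMod 2, x ∘ f ∈ L ↔ x ∈ L') : IsTripleSystem (p ∘ f) L where
  exists_fiber a := by
    obtain ⟨b, c, h1, h2, h3, h⟩ := hp.exists_fiber (f a)
    refine ⟨f.symm b, f.symm c, ?_, ?_, ?_, fun x => ?_⟩
    · rwa [Ne, Equiv.symm_apply_eq]
    · rwa [Ne, Equiv.symm_apply_eq]
    · simpa
    · simp only [Function.comp_apply, h, Equiv.eq_symm_apply, f.injective.eq_iff]
  even x hx a b c h1 h2 h3 h4 h5 := by
    have hx' : x ∘ f.symm ∈ L' := (hf _).1 (by simpa [Function.comp_assoc] using hx)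
    simpa using hp.even _ hx' (f a) (f b) (f c) (by simpa) (by simpa) (by simpa) h4 h5
  dual a b c h1 h2 h3 h := by
    have := hp.dual (f a) (f b) (f c) h1 h2 h3 fun x hx => h _ ((hf x).2 hx)
    convert (hf _).2 this using 1
    funext y
    rw [Function.comp_apply]
    refine @if_congr _ _ _ (_) (_) _ _ _ _ ?_ rfl rfl
    simp

theorem IsTripleSystem.exists_third (hp : IsTripleSystem p L) {a b : α} (hab : b ≠ a)
    (h : p b = p a) : ∃ c, c ≠ a ∧ c ≠ b ∧ ∀ x, p x = p a ↔ x = a ∨ x = b ∨ x = c := by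
  obtain ⟨c, d, h1, h2, h3, h4⟩ := hp.exists_fiber a
  rcases (h4 b).1 h with e | e | e
  · exact absurd e hab
  · exact ⟨d, h2, by rw [e]; exact h3.symm, fun x => by rw [h4, e]⟩
  · exact ⟨c, h1, by rw [e]; exact h3, fun x => by rw [h4, e]; tauto⟩

theorem IsTripleSystem.mem_fiber (hp : IsTripleSystem p L) {a b c x : α} (hab : b ≠ a)
    (hac : c ≠ a) (hbc : b ≠ c) (hb : p b = p a) (hc : p c = p a) (hx : p x = p a) :
    x = a ∨ x = b ∨ x = c := by
  obtain ⟨d, _, _, h3⟩ := hp.exists_third hab hb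
  have h4 := (h3 c).1 hc
  have h5 := (h3 x).1 hx
  grind

theorem FibersAgree.of_eq {a b : α} (h : FibersAgree p q a) (hab : q b = q a) :
    FibersAgree p q b := fun c => by
  rw [(h b).2 hab, hab, h c]

/-- The fiber through an element of agreement consists of elements of agreement, all fixed by `σ`;
the others are permuted among themselves, so nothing enters this fiber. -/
theorem FibersAgree.comp_perm {σ : Equiv.Perm α} (hσ : ∀ a, FibersAgree p q a → σ a = a) {a : α}
    (ha : FibersAgree p q a) : FibersAgree (p ∘ σ) q a := by
  intro y
  by_cases hy : FibersAgree p q y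
  · simp only [Function.comp_apply, hσ a ha, hσ y hy]
    exact ha y
  have h1 : ¬FibersAgree p q (σ y) := fun h => hy (by
    have := σ.injective (hσ _ h)
    rwa [this] at h)
  simp only [Function.comp_apply, hσ a ha]
  constructor
  · intro h
    exact absurd (ha.of_eq ((ha _).1 h)) h1
  · intro h
    exact absurd (ha.of_eq h) hy

/-- The number of elements at which the fibers differ. -/
noncomputable def disagreement (p : α → V) (q : α → W) : ℕ := {a | ¬FibersAgree p q a}.ncard

theorem disagreement_comp_perm_lt [Finite α] {σ : Equiv.Perm α}
    (hσ : ∀ a, FibersAgree p q a → σ a = a) {a : α} (ha : ¬FibersAgree p q a)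
    (ha' : FibersAgree (p ∘ σ) q a) : disagreement (p ∘ σ) q < disagreement p q :=
  Set.ncard_lt_ncard <| (Set.ssubset_iff_of_subset fun b (hb : ¬FibersAgree (p ∘ σ) q b) h =>
    hb (FibersAgree.comp_perm hσ h)).2 ⟨a, ha, fun h => h ha'⟩

/-- For fibers `{a, b, c}` of `p` and `{a, b, d}` of `q`, evenness gives `x c = x a + x b = x d` on
`L`, so exchanging `c` and `d` preserves `L` and aligns the two fibers. -/
theorem exists_preserves_of_common_pair [Finite α] (hp : IsTripleSystem p L)
    (hq : IsTripleSystem q L) {a b : α} (hab : b ≠ a) (hpab : p b = p a) (hqab : q b = q a)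
    (ha : ¬FibersAgree p q a) :
    ∃ σ : Equiv.Perm α, Preserves σ L ∧ disagreement (p ∘ σ) q < disagreement p q := by
  classical
  obtain ⟨c, hca, hcb, hc⟩ := hp.exists_third hab hpab
  obtain ⟨d, hda, hdb, hd⟩ := hq.exists_third hab hqab
  have hcd : c ≠ d := fun e => ha fun y => by rw [hc, hd, e]
  have hqc : q c ≠ q a := fun h => by have := (hd c).1 h; tauto
  have hpd : p d ≠ p a := fun h => by have := (hc d).1 h; tauto
  have hpc : p c = p a := (hc c).2 (by simp)
  have hqd : q d = q a := (hd d).2 (by simp)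
  refine ⟨Equiv.swap c d, preserves_of_involutive (fun y => by simp)
    fun x hx => ?_, disagreement_comp_perm_lt (fun y hy => ?_) ha fun y => ?_⟩
  · have h1 := hp.even x hx a b c hab.symm hca.symm hcb.symm hpab hpc
    have h2 := hq.even x hx a b d hab.symm hda.symm hdb.symm hqab hqd
    have h3 : x c = x d := add_left_cancel (h1.trans h2.symm)
    convert hx using 1
    funext y
    simp only [Function.comp_apply, Equiv.swap_apply_def]
    split_ifs with e1 e2
    · rw [e1, h3]
    · rw [e2, h3]
    · rfl
  · refine Equiv.swap_apply_of_ne_of_ne ?_ ?_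
    · rintro rfl
      exact hqc ((hy a).1 hpc.symm).symm
    · rintro rfl
      exact hpd ((hy a).2 hqd.symm).symm
  · simp only [Function.comp_apply, Equiv.swap_apply_of_ne_of_ne hca.symm hda.symm, hc, hd,
      Equiv.swap_apply_def]
    grind

/-- Since `{a, b, c}` is a `q`-fiber transversal to `p`, `dual` gives a vector of `L` supported on
the six other elements of the three `p`-fibers. Even weight on the `q`-fiber through `d`, one of the
six, forces exactly one more of the six into it. -/
theorem IsTripleSystem.exists_partner (hp : IsTripleSystem p L) (hq : IsTripleSystem q L)
    (hpq : ∀ a b, b ≠ a → p b = p a → q b = q a → FibersAgree p q a) {a b c d : α}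
    (hqb : q b = q a) (hqc : q c = q a) (hab : p a ≠ p b) (hac : p a ≠ p c) (hbc : p b ≠ p c)
    (hd : p d = p a ∨ p d = p b ∨ p d = p c) (hqd : q d ≠ q a) (hdd : ¬FibersAgree p q d) :
    ∃ e f, e ≠ d ∧ f ≠ d ∧ e ≠ f ∧ (∀ x, q x = q d ↔ x = d ∨ x = e ∨ x = f) ∧
      (p e = p a ∨ p e = p b ∨ p e = p c) ∧ p e ≠ p d ∧ p f ≠ p a ∧ p f ≠ p b ∧ p f ≠ p c := by
  have nab : a ≠ b := fun h => hab (h ▸ rfl)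
  have nac : a ≠ c := fun h => hac (h ▸ rfl)
  have nbc : b ≠ c := fun h => hbc (h ▸ rfl)
  have hl := hp.dual a b c hab hac hbc fun x hx => hq.even x hx a b c nab nac nbc hqb hqc
  obtain ⟨e, f, h1, h2, h3, h⟩ := hq.exists_fiber d
  have hqe : q e = q d := (h e).2 (by simp)
  have hqf : q f = q d := (h f).2 (by simp)
  have hs := hq.even _ hl d e f h1.symm h2.symm h3 hqe hqf
  have key : ∀ y, q y = q d → y ≠ a ∧ y ≠ b ∧ y ≠ c := fun y hy => by
    refine ⟨?_, ?_, ?_⟩ <;> rintro rfl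
    · exact hqd hy.symm
    · exact hqd (hy.symm.trans hqb)
    · exact hqd (hy.symm.trans hqc)
  have kp : ∀ y, y ≠ d → q y = q d → p y ≠ p d := fun y hy hy' hpy => hdd (hpq d y hy hpy hy')
  beta_reduce at hs
  rw [if_pos ⟨hd, key d rfl⟩] at hs
  by_cases he : p e = p a ∨ p e = p b ∨ p e = p c
  · by_cases hf : p f = p a ∨ p f = p b ∨ p f = p c
    · rw [if_pos ⟨he, key e hqe⟩, if_pos ⟨hf, key f hqf⟩] at hs
      exact absurd hs (by decide)
    · push Not at hf
      exact ⟨e, f, h1, h2, h3, h, he, kp e h1 hqe, hf⟩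
  · by_cases hf : p f = p a ∨ p f = p b ∨ p f = p c
    · push Not at he
      exact ⟨f, e, h2, h1, h3.symm, fun x => by rw [h]; tauto, hf, kp f h2 hqf, he⟩
    · rw [if_neg fun h => he h.1, if_neg fun h => hf h.1] at hs
      exact absurd hs (by decide)

/-! ### Crossings of two triple systems -/

/-- Four fibers of `p` and four fibers of `q`, matched so that `P i` and `Q j` meet for `i ≠ j`
only, in the element `g i j`. -/
structure IsCrossing (p : α → V) (q : α → W) (P : Fin 4 → V) (Q : Fin 4 → W)
    (g : Fin 4 → Fin 4 → α) : Prop where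
  injective_left : Function.Injective P
  injective_right : Function.Injective Q
  left : ∀ i j, i ≠ j → p (g i j) = P i
  right : ∀ i j, i ≠ j → q (g i j) = Q j

theorem injective_vec_four {a b c d : V} (hab : a ≠ b) (hac : a ≠ c) (had : a ≠ d) (hbc : b ≠ c)
    (hbd : b ≠ d) (hcd : c ≠ d) : Function.Injective ![a, b, c, d] := by
  intro i j h
  fin_cases i <;> fin_cases j <;>
    first
      | rfl
      | exact absurd h hab | exact absurd h hac | exact absurd h had
      | exact absurd h hbc | exact absurd h hbd | exact absurd h hcd
      | exact absurd h.symm hab | exact absurd h.symm hac | exact absurd h.symm had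
      | exact absurd h.symm hbc | exact absurd h.symm hbd | exact absurd h.symm hcd

/-- By `exists_partner`, `q`-fibers pair up the six remaining elements of the `p`-fibers of `a₁`,
`b₁`, `c₁`. Once `a₂` is paired with `b₂`, both `a₃` and `b₃` must be paired with elements of the
fiber of `c₁`. The third elements `x`, `y`, `z` of these `q`-fibers then make up the fourth
`p`-fiber. -/
theorem exists_isCrossing_aux (hp : IsTripleSystem p L) (hq : IsTripleSystem q L)
    (hpq : ∀ a b, b ≠ a → p b = p a → q b = q a → FibersAgree p q a) {a₁ a₂ a₃ b₁ b₂ c₁ x : α}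
    (ha : ¬FibersAgree p q a₁)
    (hab : p a₁ ≠ p b₁) (hac : p a₁ ≠ p c₁) (hbc : p b₁ ≠ p c₁)
    (hq₁ : ∀ y, q y = q a₁ ↔ y = a₁ ∨ y = b₁ ∨ y = c₁)
    (h21 : a₂ ≠ a₁) (h31 : a₃ ≠ a₁) (h23 : a₂ ≠ a₃)
    (hA : ∀ y, p y = p a₁ ↔ y = a₁ ∨ y = a₂ ∨ y = a₃)
    (hb₂ : p b₂ = p b₁) (hq₂ : ∀ y, q y = q a₂ ↔ y = a₂ ∨ y = b₂ ∨ y = x)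
    (hxa : p x ≠ p a₁) (hxb : p x ≠ p b₁) (hxc : p x ≠ p c₁) :
    ∃ P Q g, IsCrossing p q P Q g := by
  have bad_q : ∀ {y z}, ¬FibersAgree p q y → q z = q y → ¬FibersAgree p q z :=
    fun h1 h2 h3 => h1 (h3.of_eq h2.symm)
  have bad_p : ∀ {y z}, ¬FibersAgree p q y → p z = p y → ¬FibersAgree p q z :=
    fun h1 h2 h3 => h1 (h3.of_eq ((h3 _).1 h2.symm))
  have U : ∀ {y z}, ¬FibersAgree p q y → p z = p y → z ≠ y → q z ≠ q y :=
    fun h1 h2 h3 h4 => h1 (hpq _ _ h3 h2 h4)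
  have qb₁ : q b₁ = q a₁ := (hq₁ _).2 (by simp)
  have qc₁ : q c₁ = q a₁ := (hq₁ _).2 (by simp)
  have pa₂ : p a₂ = p a₁ := (hA _).2 (by simp)
  have pa₃ : p a₃ = p a₁ := (hA _).2 (by simp)
  have bad_b := bad_q ha qb₁
  have bad_c := bad_q ha qc₁
  have bad₂ := bad_p ha pa₂
  have bad₃ := bad_p ha pa₃
  have qb₂ : q b₂ = q a₂ := (hq₂ _).2 (by simp)
  have qx : q x = q a₂ := (hq₂ _).2 (by simp)
  have q21 : q a₂ ≠ q a₁ := U ha pa₂ h21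
  have q31 : q a₃ ≠ q a₁ := U ha pa₃ h31
  have q32 : q a₃ ≠ q a₂ := U bad₂ (pa₃.trans pa₂.symm) h23.symm
  have nb₂ : b₂ ≠ b₁ := fun e => q21 (by rw [← qb₂, e, qb₁])
  obtain ⟨b₃, hb31, hb32, hB⟩ := hp.exists_third nb₂ hb₂
  have pb₃ : p b₃ = p b₁ := (hB _).2 (by simp)
  have bad_b₂ := bad_p bad_b hb₂
  have bad_b₃ := bad_p bad_b pb₃
  have qb31 : q b₃ ≠ q a₁ := qb₁ ▸ U bad_b pb₃ hb31
  have qb32 : q b₃ ≠ q a₂ := qb₂ ▸ U bad_b₂ (pb₃.trans hb₂.symm) hb32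
  obtain ⟨e, y, e1, e2, e3, hq₃, he, he', hya, hyb, hyc⟩ :=
    hp.exists_partner hq hpq qb₁ qc₁ hab hac hbc (d := a₃) (.inl pa₃) q31 bad₃
  have qe : q e = q a₃ := (hq₃ _).2 (by simp)
  have qy : q y = q a₃ := (hq₃ _).2 (by simp)
  have pe : p e = p c₁ := by
    rcases he with he | he | he
    · exact absurd (he.trans pa₃.symm) he'
    -- If `a₃` were paired with `b₃`, then `c₂` would have no partner left in the other two
    -- `p`-fibers.
    · exfalso
      have he₃ : e = b₃ := by
        rcases (hB e).1 he with rfl | rfl | rfl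
        · exact absurd (qe.symm.trans qb₁) q31
        · exact absurd (qe.symm.trans qb₂) q32
        · rfl
      subst he₃
      obtain ⟨c₂, c₃, hc21, hc31, hc23, hC⟩ := hp.exists_fiber c₁
      have pc₂ : p c₂ = p c₁ := (hC _).2 (by simp)
      have bad_c₂ := bad_p bad_c pc₂
      have qc21 : q c₂ ≠ q a₁ := qc₁ ▸ U bad_c pc₂ hc21
      obtain ⟨u, v, -, -, -, hqu, hu, hu', -⟩ :=
        hp.exists_partner hq hpq qb₁ qc₁ hab hac hbc (d := c₂) (.inr (.inr pc₂)) qc21 bad_c₂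
      have qu : q c₂ = q u := ((hqu u).2 (by simp)).symm
      have n2 : q c₂ ≠ q a₂ := fun h => by
        rcases (hq₂ c₂).1 h with rfl | rfl | rfl
        · exact hac (pa₂.symm.trans pc₂)
        · exact hbc (hb₂.symm.trans pc₂)
        · exact hxc pc₂
      have n3 : q c₂ ≠ q a₃ := fun h => by
        rcases (hq₃ c₂).1 h with rfl | rfl | rfl
        · exact hac (pa₃.symm.trans pc₂)
        · exact hbc (he.symm.trans pc₂)
        · exact hyc pc₂
      rcases hu with hu | hu | hu
      · rcases (hA u).1 hu with rfl | rfl | rfl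
        · exact qc21 qu
        · exact n2 qu
        · exact n3 qu
      · rcases (hB u).1 hu with rfl | rfl | rfl
        · exact qc21 (qu.trans qb₁)
        · exact n2 (qu.trans qb₂)
        · exact n3 (qu.trans qe)
      · exact hu' (hu.trans pc₂.symm)
    · exact he
  have ne : e ≠ c₁ := fun h => q31 (by rw [← qe, h, qc₁])
  obtain ⟨c₃, hc31, hc32, hC⟩ := hp.exists_third ne pe
  have pc₃ : p c₃ = p c₁ := (hC _).2 (by simp)
  obtain ⟨u, z, -, -, -, hq₄, hu, hu', hza, hzb, hzc⟩ :=
    hp.exists_partner hq hpq qb₁ qc₁ hab hac hbc (d := b₃) (.inr (.inl pb₃)) qb31 bad_b₃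
  have qu : q u = q b₃ := (hq₄ _).2 (by simp)
  have qz : q z = q b₃ := (hq₄ _).2 (by simp)
  have qb33 : q b₃ ≠ q a₃ := fun h => by
    rcases (hq₃ b₃).1 h with rfl | rfl | rfl
    · exact hab (pa₃.symm.trans pb₃)
    · exact hbc (pb₃.symm.trans pe)
    · exact hyb pb₃
  have hu₃ : u = c₃ := by
    rcases hu with hu | hu | hu
    · exfalso
      rcases (hA u).1 hu with rfl | rfl | rfl
      · exact qb31 qu.symm
      · exact qb32 qu.symm
      · exact qb33 qu.symm
    · exact absurd (hu.trans pb₃.symm) hu'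
    · rcases (hC u).1 hu with rfl | rfl | rfl
      · exact absurd (qu.symm.trans qc₁) qb31
      · exact absurd (qu.symm.trans qe) qb33
      · rfl
  subst hu₃
  have pab₂ : p a₂ ≠ p b₂ := by rwa [pa₂, hb₂]
  have pax : p a₂ ≠ p x := by rw [pa₂]; exact hxa.symm
  have pbx : p b₂ ≠ p x := by rw [hb₂]; exact hxb.symm
  -- The `q`-fiber `{a₂, b₂, x}` is transversal to `p` as well. Relative to it the partner of `a₃`
  -- cannot be `e`, which lies in the fiber of `c₁`, so it is `y`.
  have py : p y = p x := by
    obtain ⟨s, t, -, -, -, hst, hs, hs', ht⟩ := hp.exists_partner hq hpq qb₂ qx pab₂ pax pbx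
      (d := a₃) (.inl (pa₃.trans pa₂.symm)) q32 bad₃
    have qs := (hq₃ s).1 ((hst s).2 (by simp))
    rcases qs with rfl | rfl | rfl
    · exact absurd rfl hs'
    · rw [pe, pa₂, hb₂] at hs
      rcases hs with h | h | h
      · exact absurd h.symm hac
      · exact absurd h.symm hbc
      · exact absurd h.symm hxc
    · rw [pa₂, hb₂] at hs
      tauto
  have pz : p z = p x := by
    obtain ⟨s, t, -, -, -, hst, hs, hs', ht⟩ := hp.exists_partner hq hpq qb₂ qx pab₂ pax pbx
      (d := b₃) (.inr (.inl (pb₃.trans hb₂.symm))) qb32 bad_b₃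
    have qs := (hq₄ s).1 ((hst s).2 (by simp))
    rcases qs with rfl | rfl | rfl
    · exact absurd rfl hs'
    · rw [pc₃, pa₂, hb₂] at hs
      rcases hs with h | h | h
      · exact absurd h.symm hac
      · exact absurd h.symm hbc
      · exact absurd h.symm hxc
    · rw [pa₂, hb₂] at hs
      tauto
  -- `Q` is ordered so that the missing intersections fall on the diagonal, where the entries of `g`
  -- are arbitrary.
  refine ⟨![p a₁, p b₁, p c₁, p x], ![q b₃, q a₃, q a₂, q a₁],
    ![![a₁, a₃, a₂, a₁], ![b₃, a₁, b₂, b₁], ![u, e, a₁, c₁], ![z, y, x, a₁]], ?_, ?_, ?_, ?_⟩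
  · exact injective_vec_four hab hac hxa.symm hbc hxb.symm hxc.symm
  · exact injective_vec_four qb33 qb32 qb31 q32 q31 q21
  · intro i j h
    fin_cases i <;> fin_cases j <;> first | exact absurd rfl h | rfl | assumption
  · intro i j h
    fin_cases i <;> fin_cases j <;> first | exact absurd rfl h | rfl | assumption

theorem exists_isCrossing (hp : IsTripleSystem p L) (hq : IsTripleSystem q L)
    (hpq : ∀ a b, b ≠ a → p b = p a → q b = q a → FibersAgree p q a) {a : α}
    (ha : ¬FibersAgree p q a) : ∃ P Q g, IsCrossing p q P Q g := by
  obtain ⟨b, c, hba, hca, hbc, hq₁⟩ := hq.exists_fiber a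
  obtain ⟨a₂, a₃, h21, h31, h23, hA⟩ := hp.exists_fiber a
  have qb : q b = q a := (hq₁ _).2 (by simp)
  have qc : q c = q a := (hq₁ _).2 (by simp)
  have pa₂ : p a₂ = p a := (hA _).2 (by simp)
  have pab : p a ≠ p b := fun h => ha (hpq _ _ hba h.symm qb)
  have pac : p a ≠ p c := fun h => ha (hpq _ _ hca h.symm qc)
  have pbc : p b ≠ p c := fun h =>
    ha ((hpq b c hbc.symm h.symm (qc.trans qb.symm)).of_eq qb.symm)
  have qa₂ : q a₂ ≠ q a := fun h => ha (hpq _ _ h21 pa₂ h)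
  have ha₂ : ¬FibersAgree p q a₂ := fun h => ha (h.of_eq ((h _).1 pa₂.symm))
  obtain ⟨e, f, -, -, -, hq₂, he, he', hfa, hfb, hfc⟩ :=
    hp.exists_partner hq hpq qb qc pab pac pbc (d := a₂) (.inl pa₂) qa₂ ha₂
  rcases he with he | he | he
  · exact absurd (he.trans pa₂.symm) he'
  · exact exists_isCrossing_aux hp hq hpq ha pab pac pbc hq₁ h21 h31 h23 hA he hq₂ hfa hfb hfc
  · exact exists_isCrossing_aux hp hq hpq ha pac pab pbc.symm
      (fun y => by rw [hq₁]; tauto) h21 h31 h23 hA he hq₂ hfa hfc hfb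

namespace IsCrossing

variable {P : Fin 4 → V} {Q : Fin 4 → W} {g : Fin 4 → Fin 4 → α}

theorem eq_iff (h : IsCrossing p q P Q g) {i j k l : Fin 4} (hij : i ≠ j) (hkl : k ≠ l) :
    g i j = g k l ↔ i = k ∧ j = l := by
  refine ⟨fun e => ⟨h.injective_left ?_, h.injective_right ?_⟩, fun e => by rw [e.1, e.2]⟩
  · rw [← h.left i j hij, e, h.left k l hkl]
  · rw [← h.right i j hij, e, h.right k l hkl]

theorem exists_eq_of_left (h : IsCrossing p q P Q g) (hp : IsTripleSystem p L) {y : α} {i : Fin 4}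
    (hy : p y = P i) : ∃ j, i ≠ j ∧ y = g i j := by
  obtain ⟨j, k, l, hj, hk, hl, hjk, hjl, hkl⟩ : ∃ j k l : Fin 4, i ≠ j ∧ i ≠ k ∧ i ≠ l ∧
      j ≠ k ∧ j ≠ l ∧ k ≠ l := by
    clear hy
    revert i; decide
  have := hp.mem_fiber (a := g i j) (b := g i k) (c := g i l) (x := y)
    (by rw [Ne, h.eq_iff hk hj]; tauto) (by rw [Ne, h.eq_iff hl hj]; tauto)
    (by rw [Ne, h.eq_iff hk hl]; tauto) (by rw [h.left i j hj, h.left i k hk])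
    (by rw [h.left i j hj, h.left i l hl]) (by rw [h.left i j hj, hy])
  rcases this with e | e | e
  exacts [⟨j, hj, e⟩, ⟨k, hk, e⟩, ⟨l, hl, e⟩]

theorem swap (h : IsCrossing p q P Q g) : IsCrossing q p Q P fun i j => g j i where
  injective_left := h.injective_right
  injective_right := h.injective_left
  left i j hij := h.right j i hij.symm
  right i j hij := h.left j i hij.symm

open Classical in
/-- Exchange `g i j` and `g j i` and fix all other elements. -/
noncomputable def transposeFun (g : Fin 4 → Fin 4 → α) (y : α) : α :=
  if h : ∃ ij : Fin 4 × Fin 4, ij.1 ≠ ij.2 ∧ y = g ij.1 ij.2 then g h.choose.2 h.choose.1 else y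

theorem transposeFun_apply (h : IsCrossing p q P Q g) {i j : Fin 4} (hij : i ≠ j) :
    transposeFun g (g i j) = g j i := by
  have hex : ∃ ij : Fin 4 × Fin 4, ij.1 ≠ ij.2 ∧ g i j = g ij.1 ij.2 := ⟨(i, j), hij, rfl⟩
  rw [transposeFun, dif_pos hex]
  obtain ⟨h1, h2⟩ := hex.choose_spec
  obtain ⟨h3, h4⟩ := (h.eq_iff hij h1).1 h2
  rw [← h3, ← h4]

theorem transposeFun_of_ne {y : α} (hy : ∀ i j, i ≠ j → y ≠ g i j) : transposeFun g y = y := by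
  rw [transposeFun, dif_neg]
  rintro ⟨ij, h1, h2⟩
  exact hy _ _ h1 h2

theorem transposeFun_involutive (h : IsCrossing p q P Q g) :
    Function.Involutive (transposeFun g) := fun y => by
  by_cases hy : ∃ i j, i ≠ j ∧ y = g i j
  · obtain ⟨i, j, hij, rfl⟩ := hy
    rw [h.transposeFun_apply hij, h.transposeFun_apply hij.symm]
  · push Not at hy
    rw [transposeFun_of_ne hy, transposeFun_of_ne hy]

/-- `dual` is applied to the fiber `Q k`, which is a transversal of the three `p`-fibers other than
`P k`. -/
theorem exists_avoiding (h : IsCrossing p q P Q g) (hp : IsTripleSystem p L)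
    (hq : IsTripleSystem q L) (k : Fin 4) : ∃ l ∈ L,
      (∀ i j, i ≠ j → l (g i j) = if i ≠ k ∧ j ≠ k then 1 else 0) ∧
      ∀ y, (∀ i j, i ≠ j → y ≠ g i j) → l y = 0 := by
  obtain ⟨a, b, c, ha, hb, hc, hab, hac, hbc, hall⟩ : ∃ a b c : Fin 4, a ≠ k ∧ b ≠ k ∧ c ≠ k ∧
      a ≠ b ∧ a ≠ c ∧ b ≠ c ∧ ∀ i, i = a ∨ i = b ∨ i = c ∨ i = k := by revert k; decide
  refine ⟨_, hp.dual (g a k) (g b k) (g c k) ?_ ?_ ?_ fun x hx =>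
    hq.even x hx _ _ _ ?_ ?_ ?_ ?_ ?_, fun i j hij => ?_, fun y hy => ?_⟩
  · rwa [h.left a k ha, h.left b k hb, h.injective_left.ne_iff]
  · rwa [h.left a k ha, h.left c k hc, h.injective_left.ne_iff]
  · rwa [h.left b k hb, h.left c k hc, h.injective_left.ne_iff]
  · rw [Ne, h.eq_iff ha hb]; tauto
  · rw [Ne, h.eq_iff ha hc]; tauto
  · rw [Ne, h.eq_iff hb hc]; tauto
  · rw [h.right b k hb, h.right a k ha]
  · rw [h.right c k hc, h.right a k ha]
  · simp only [h.left i j hij, h.left a k ha, h.left b k hb, h.left c k hc,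
      h.injective_left.eq_iff, Ne, h.eq_iff hij ha, h.eq_iff hij hb, h.eq_iff hij hc]
    congr 1
    have := hall i
    grind
  · rw [if_neg]
    rintro ⟨h1, -⟩
    rw [h.left a k ha, h.left b k hb, h.left c k hc] at h1
    rcases h1 with h1 | h1 | h1 <;> obtain ⟨j, hj, e⟩ := h.exists_eq_of_left hp h1 <;>
      exact hy _ _ hj e

/-- The sums `x (g i j) + x (g j i)` are weights on the edges of K₄. Zero row and column sums make
them an element of the cycle space, hence a combination of the triangles through 0, each with the
weight of its edge opposite 0. `exists_avoiding` supplies these triangles as vectors of `L`. -/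
theorem comp_transposeFun_mem (h : IsCrossing p q P Q g) (hp : IsTripleSystem p L)
    (hq : IsTripleSystem q L) {x : α → ZMod 2} (hx : x ∈ L) : x ∘ transposeFun g ∈ L := by
  have row : ∀ i j k l : Fin 4, i ≠ j → i ≠ k → i ≠ l → j ≠ k → j ≠ l → k ≠ l →
      x (g i j) + x (g i k) + x (g i l) = 0 := by
    intro i j k l hj hk hl hjk hjl hkl
    refine hp.even x hx _ _ _ ?_ ?_ ?_ ?_ ?_
    · rw [Ne, h.eq_iff hj hk]; tauto
    · rw [Ne, h.eq_iff hj hl]; tauto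
    · rw [Ne, h.eq_iff hk hl]; tauto
    · rw [h.left i k hk, h.left i j hj]
    · rw [h.left i l hl, h.left i j hj]
  have col : ∀ i j k l : Fin 4, i ≠ j → i ≠ k → i ≠ l → j ≠ k → j ≠ l → k ≠ l →
      x (g j i) + x (g k i) + x (g l i) = 0 := by
    intro i j k l hj hk hl hjk hjl hkl
    refine hq.even x hx _ _ _ ?_ ?_ ?_ ?_ ?_
    · rw [Ne, h.eq_iff hj.symm hk.symm]; tauto
    · rw [Ne, h.eq_iff hj.symm hl.symm]; tauto
    · rw [Ne, h.eq_iff hk.symm hl.symm]; tauto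
    · rw [h.right k i hk.symm, h.right j i hj.symm]
    · rw [h.right l i hl.symm, h.right j i hj.symm]
  have r1 := row 1 0 2 3 (by decide) (by decide) (by decide) (by decide) (by decide) (by decide)
  have r2 := row 2 0 1 3 (by decide) (by decide) (by decide) (by decide) (by decide) (by decide)
  have r3 := row 3 0 1 2 (by decide) (by decide) (by decide) (by decide) (by decide) (by decide)
  have c1 := col 1 0 2 3 (by decide) (by decide) (by decide) (by decide) (by decide) (by decide)
  have c2 := col 2 0 1 3 (by decide) (by decide) (by decide) (by decide) (by decide) (by decide)
  have c3 := col 3 0 1 2 (by decide) (by decide) (by decide) (by decide) (by decide) (by decide)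
  obtain ⟨l₁, m₁, v₁, z₁⟩ := h.exists_avoiding hp hq 1
  obtain ⟨l₂, m₂, v₂, z₂⟩ := h.exists_avoiding hp hq 2
  obtain ⟨l₃, m₃, v₃, z₃⟩ := h.exists_avoiding hp hq 3
  have key : x ∘ transposeFun g = x + (x (g 2 3) + x (g 3 2)) • l₁ +
      (x (g 1 3) + x (g 3 1)) • l₂ + (x (g 1 2) + x (g 2 1)) • l₃ := by
    funext y
    simp only [Function.comp_apply, Pi.add_apply, Pi.smul_apply, smul_eq_mul]
    by_cases hy : ∃ i j, i ≠ j ∧ y = g i j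
    · obtain ⟨i, j, hij, rfl⟩ := hy
      rw [h.transposeFun_apply hij, v₁ i j hij, v₂ i j hij, v₃ i j hij]
      fin_cases i <;> fin_cases j <;> first | exact absurd rfl hij | (simp; grind)
    · push Not at hy
      rw [transposeFun_of_ne hy, z₁ y hy, z₂ y hy, z₃ y hy]
      ring
  rw [key]
  exact add_mem (add_mem (add_mem hx (L.smul_mem _ m₁)) (L.smul_mem _ m₂)) (L.smul_mem _ m₃)

end IsCrossing

theorem exists_preserves_of_no_common_pair [Finite α] (hp : IsTripleSystem p L)
    (hq : IsTripleSystem q L)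
    (hpq : ∀ a b, b ≠ a → p b = p a → q b = q a → FibersAgree p q a) {a : α}
    (ha : ¬FibersAgree p q a) :
    ∃ σ : Equiv.Perm α, Preserves σ L ∧ disagreement (p ∘ σ) q < disagreement p q := by
  obtain ⟨P, Q, g, h⟩ := exists_isCrossing hp hq hpq ha
  have h01 : (0 : Fin 4) ≠ 1 := by decide
  have hbad : ∀ i j, i ≠ j → ¬FibersAgree p q (g i j) := by
    intro i j hij hb
    obtain ⟨k, hik, hjk⟩ : ∃ k : Fin 4, i ≠ k ∧ j ≠ k := by
      clear hb
      revert i j; decide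
    have := (hb (g i k)).1 (by rw [h.left i k hik, h.left i j hij])
    rw [h.right i k hik, h.right i j hij] at this
    exact hjk (h.injective_right this.symm)
  -- All cells of the crossing are points of disagreement, so transposing it leaves the common
  -- fibers alone; afterwards the fiber `P j` occupies the place of `Q j`.
  refine ⟨h.transposeFun_involutive.toPerm, preserves_of_involutive h.transposeFun_involutive
    fun x hx => h.comp_transposeFun_mem hp hq hx,
    disagreement_comp_perm_lt (fun y hy => ?_) (hbad 0 1 h01) fun y => ?_⟩
  · refine IsCrossing.transposeFun_of_ne fun i j hij e => hbad i j hij (e ▸ hy)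
  · simp only [Function.comp_apply, Function.Involutive.coe_toPerm, h.transposeFun_apply h01,
      h.left 1 0 h01.symm, h.right 0 1 h01]
    by_cases hy : ∃ i j, i ≠ j ∧ y = g i j
    · obtain ⟨i, j, hij, rfl⟩ := hy
      rw [h.transposeFun_apply hij, h.left j i hij.symm, h.right i j hij, h.injective_left.eq_iff,
        h.injective_right.eq_iff]
    · push Not at hy
      rw [IsCrossing.transposeFun_of_ne hy]
      constructor
      · intro e
        obtain ⟨j, hj, e'⟩ := h.exists_eq_of_left hp e
        exact absurd e' (hy _ _ hj)
      · intro e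
        obtain ⟨j, hj, e'⟩ := h.swap.exists_eq_of_left hq e
        exact absurd e' (hy _ _ hj.symm)

theorem exists_preserves_fibers_eq [Finite α] (hq : IsTripleSystem q L) (n : ℕ) :
    ∀ {p : α → V}, IsTripleSystem p L → disagreement p q = n →
      ∃ σ : Equiv.Perm α, Preserves σ L ∧ ∀ a b, p (σ a) = p (σ b) ↔ q a = q b := by
  induction n using Nat.strong_induction_on with
  | _ n ih =>
    intro p hp hn
    by_cases hall : ∀ a, FibersAgree p q a
    · exact ⟨1, fun x => Iff.rfl, fun a b => hall b a⟩
    push Not at hall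
    obtain ⟨a, ha⟩ := hall
    obtain ⟨σ, hσ, hlt⟩ : ∃ σ : Equiv.Perm α, Preserves σ L ∧
        disagreement (p ∘ σ) q < disagreement p q := by
      by_cases hpq : ∀ a b, b ≠ a → p b = p a → q b = q a → FibersAgree p q a
      · exact exists_preserves_of_no_common_pair hp hq hpq ha
      · push Not at hpq
        obtain ⟨a, b, h1, h2, h3, h4⟩ := hpq
        exact exists_preserves_of_common_pair hp hq h1 h2 h3 h4
    obtain ⟨τ, hτ, h⟩ := ih _ (hn ▸ hlt) (hp.comp_equiv σ hσ) rfl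
    refine ⟨τ.trans σ, fun x => ?_, h⟩
    rw [← hσ x, ← hτ (x ∘ σ)]
    rfl

end Triples

/-! ### Local equivalence as permutation inside the triples -/

theorem LoopedGraph.locallyEquivalent_loopComplement {V : Type*} (G : LoopedGraph V) (v : V) :
    G.LocallyEquivalent (G.loopComplement v) :=
  Relation.ReflTransGen.single ⟨v, .inl rfl⟩

theorem LoopedGraph.locallyEquivalent_nonsimpleComplement {V : Type*} (G : LoopedGraph V) (v : V) :
    G.LocallyEquivalent (G.nonsimpleComplement v) :=
  Relation.ReflTransGen.single ⟨v, .inr (.inr rfl)⟩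

section Twist

variable {V W : Type*} [Fintype V] [Fintype W]

open Classical in
/-- The loop status of a vertex as an element of `GF(2)`. -/
noncomputable def loopStatus {V : Type*} (G : LoopedGraph V) (v : V) : ZMod 2 :=
  if v ∈ G.loops then 1 else 0

/-- The row space of `IAS(G)`, where `(v, 0)`, `(v, 1)`, `(v, 2)` stand for the columns `φ(v)`,
`χ(v)`, `ψ(v)`. -/
noncomputable def isotropicSpace (G : LoopedGraph V) :
    Submodule (ZMod 2) (V × Fin 3 → ZMod 2) where
  carrier := {x | ∀ v,
    x (v, 1) = ∑ u, adj G.toSimpleGraph u v * x (u, 0) + loopStatus G v * x (v, 0) ∧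
      x (v, 2) = x (v, 0) + x (v, 1)}
  add_mem' := fun {x z} hx hz v => by
    simp only [Pi.add_apply, mul_add, Finset.sum_add_distrib, (hx v).1, (hz v).1, (hx v).2,
      (hz v).2]
    constructor <;> ring
  zero_mem' := fun v => by simp
  smul_mem' := fun c x hx v => by
    simp only [Pi.smul_apply, smul_eq_mul, (hx v).1, (hx v).2]
    refine ⟨?_, by ring⟩
    rw [mul_add, Finset.mul_sum]
    congr 1
    · exact Finset.sum_congr rfl fun _ _ => by ring
    · ring

theorem mem_isotropicSpace {G : LoopedGraph V} {x : V × Fin 3 → ZMod 2} :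
    x ∈ isotropicSpace G ↔ ∀ v,
      x (v, 1) = ∑ u, adj G.toSimpleGraph u v * x (u, 0) + loopStatus G v * x (v, 0) ∧
        x (v, 2) = x (v, 0) + x (v, 1) := Iff.rfl

theorem exists_mem_isotropicSpace (G : LoopedGraph V) (z : V → ZMod 2) :
    ∃ x ∈ isotropicSpace G, ∀ v, x (v, 0) = z v := by
  refine ⟨fun a => ![z a.1, ∑ u, adj G.toSimpleGraph u a.1 * z u + loopStatus G a.1 * z a.1,
    z a.1 + (∑ u, adj G.toSimpleGraph u a.1 * z u + loopStatus G a.1 * z a.1)] a.2,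
    fun v => ?_, fun v => rfl⟩
  exact ⟨rfl, rfl⟩

/-- Permute the coordinates inside the triples. -/
def twist {V : Type*} (s : V → Equiv.Perm (Fin 3)) (x : V × Fin 3 → ZMod 2) :
    V × Fin 3 → ZMod 2 :=
  fun a => x (a.1, s a.1 a.2)

/-- `s` carries the isotropic space of `G` to that of `H`. -/
def TwistedBy (s : V → Equiv.Perm (Fin 3)) (G H : LoopedGraph V) : Prop :=
  ∀ x, x ∈ isotropicSpace G ↔ twist s x ∈ isotropicSpace H

theorem twist_twist_inv {V : Type*} (s : V → Equiv.Perm (Fin 3)) (x : V × Fin 3 → ZMod 2) :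
    twist s (twist s⁻¹ x) = x := by
  funext a; simp [twist]

theorem TwistedBy.symm {s : V → Equiv.Perm (Fin 3)} {G H : LoopedGraph V}
    (h : TwistedBy s G H) : TwistedBy s⁻¹ H G := fun x => by
  rw [h, twist_twist_inv]

theorem TwistedBy.trans {s t : V → Equiv.Perm (Fin 3)} {G H K : LoopedGraph V}
    (h : TwistedBy s G H) (h' : TwistedBy t H K) : TwistedBy (s * t) G K := fun x => by
  rw [h, h']; rfl

open Classical in
theorem twistedBy_of_toSimpleGraph_eq {G H : LoopedGraph V}
    (h : G.toSimpleGraph = H.toSimpleGraph) :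
    TwistedBy (fun v => if v ∈ G.loops ↔ v ∈ H.loops then 1 else Equiv.swap 1 2) G H := by
  intro x
  refine forall_congr' fun v => ?_
  have h0 : ∀ u, twist (fun v => if v ∈ G.loops ↔ v ∈ H.loops then 1 else Equiv.swap 1 2) x (u, 0)
      = x (u, 0) := fun u => by
    unfold twist
    dsimp only
    split_ifs
    · rfl
    · rw [Equiv.swap_apply_of_ne_of_ne (by decide) (by decide)]
  simp only [h0, h]
  generalize ∑ u, adj H.toSimpleGraph u v * x (u, 0) = c
  simp only [twist, loopStatus]
  by_cases h1 : v ∈ G.loops <;> by_cases h2 : v ∈ H.loops <;>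
    simp only [h1, h2, if_true, if_false, iff_true, iff_false, not_true,
      Equiv.Perm.one_apply, Equiv.swap_apply_left, Equiv.swap_apply_right] <;>
  · generalize x (v, 0) = a0
    generalize x (v, 1) = a1
    generalize x (v, 2) = a2
    revert c a0 a1 a2
    decide

open Classical in
theorem twistedBy_loopComplement (G : LoopedGraph V) (v : V) :
    TwistedBy (Pi.mulSingle v (Equiv.swap 1 2)) G (G.loopComplement v) := by
  convert twistedBy_of_toSimpleGraph_eq (G := G) (H := G.loopComplement v) rfl using 1
  funext u
  by_cases hu : u = v
  · subst hu
    simp [LoopedGraph.loopComplement, Set.mem_symmDiff]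
  · simp [LoopedGraph.loopComplement, Set.mem_symmDiff, hu]

open Classical in
-- The loop makes the equation at `v` symmetric in `x (v, 0)` and `x (v, 1)`, so χ(v) can replace
-- φ(v) in the basis. Eliminating `x (v, 0)` from the equation at `u` adds the products `adj v u *
-- adj v w`; the case `w = u` accounts for the loops.
theorem twistedBy_nonsimpleComplement {G : LoopedGraph V} {v : V} (hv : v ∈ G.loops) :
    TwistedBy (Pi.mulSingle v (Equiv.swap 0 1)) G (G.nonsimpleComplement v) := by
  intro x
  set y := twist (Pi.mulSingle v (Equiv.swap 0 1)) x with hy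
  have y0 : y (v, 0) = x (v, 1) := by simp [hy, twist]
  have y1 : y (v, 1) = x (v, 0) := by simp [hy, twist]
  have y2 : y (v, 2) = x (v, 2) := by
    simp only [hy, twist, Pi.mulSingle_eq_same]
    rw [Equiv.swap_apply_of_ne_of_ne (by decide) (by decide)]
  have yu : ∀ u, u ≠ v → ∀ k, y (u, k) = x (u, k) := fun u hu k => by simp [hy, twist, hu]
  have hloop : ∀ u, loopStatus (G.nonsimpleComplement v) u =
      loopStatus G u + adj G.toSimpleGraph v u := fun u => by
    by_cases h1 : u ∈ G.loops <;> by_cases h2 : G.toSimpleGraph.Adj v u <;>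
      simp [loopStatus, LoopedGraph.nonsimpleComplement, adj, Set.mem_symmDiff, h1, h2] <;> decide
  have hsum : ∀ u, ∑ w, adj (G.nonsimpleComplement v).toSimpleGraph w u * y (w, 0) +
      loopStatus (G.nonsimpleComplement v) u * y (u, 0) =
      ∑ w, adj G.toSimpleGraph w u * y (w, 0) + loopStatus G u * y (u, 0) +
        adj G.toSimpleGraph v u * ∑ w, adj G.toSimpleGraph w v * y (w, 0) := fun u => by
    have : ∀ w, adj (G.nonsimpleComplement v).toSimpleGraph w u * y (w, 0) =
        adj G.toSimpleGraph w u * y (w, 0) +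
          adj G.toSimpleGraph v u * (adj G.toSimpleGraph w v * y (w, 0)) +
          if w = u then adj G.toSimpleGraph v u * y (u, 0) else 0 := fun w => by
      change adj (simpleLocalComplement G.toSimpleGraph v) w u * _ = _
      rw [adj_simpleLocalComplement, adj_comm _ w v]
      by_cases hwu : w = u
      · subst hwu
        simp only [adj_self, if_true]
        generalize adj G.toSimpleGraph v w = a
        generalize y (w, 0) = b
        revert a b; decide
      · simp only [hwu, if_false]; ring
    simp only [this, Finset.sum_add_distrib, hloop, ← Finset.mul_sum]
    simp only [Finset.sum_ite_eq', Finset.mem_univ, if_true]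
    generalize adj G.toSimpleGraph v u * ∑ w, adj G.toSimpleGraph w v * y (w, 0) = a
    generalize ∑ w, adj G.toSimpleGraph w u * y (w, 0) = b
    generalize adj G.toSimpleGraph v u = c
    generalize loopStatus G u = d
    generalize y (u, 0) = e
    revert a b c d e; decide
  have hS : ∀ u, ∑ w, adj G.toSimpleGraph w u * y (w, 0) =
      ∑ w, adj G.toSimpleGraph w u * x (w, 0) +
        adj G.toSimpleGraph v u * (x (v, 0) + x (v, 1)) := fun u => by
    have : ∀ w, adj G.toSimpleGraph w u * y (w, 0) = adj G.toSimpleGraph w u * x (w, 0) +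
        if w = v then adj G.toSimpleGraph v u * (x (v, 0) + x (v, 1)) else 0 := fun w => by
      by_cases hw : w = v
      · subst hw
        rw [y0, if_pos rfl]
        generalize adj G.toSimpleGraph w u = a
        generalize x (w, 0) = b
        generalize x (w, 1) = c
        revert a b c; decide
      · rw [yu w hw, if_neg hw, add_zero]
    simp only [this, Finset.sum_add_distrib]
    simp
  have hlv : loopStatus G v = 1 := by simp [loopStatus, hv]
  simp only [mem_isotropicSpace, hsum, hS, adj_self, zero_mul, add_zero]
  generalize hc : ∑ w, adj G.toSimpleGraph w v * x (w, 0) = c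
  constructor
  · intro h u
    have h1 := h v
    rw [hc, hlv] at h1
    by_cases hu : u = v
    · subst hu
      rw [y0, y1, y2, hc, hlv, adj_self]
      generalize x (u, 0) = a0 at *
      generalize x (u, 1) = a1 at *
      generalize x (u, 2) = a2 at *
      clear hc hsum hS yu h
      revert h1
      clear_value y
      clear y0 y1 y2
      revert c a0 a1 a2; decide
    · rw [yu u hu, yu u hu, yu u hu, (h u).2, (h u).1, h1.1]
      refine ⟨?_, rfl⟩
      generalize x (v, 0) = a0
      generalize adj G.toSimpleGraph v u = d
      generalize ∑ w, adj G.toSimpleGraph w u * x (w, 0) = b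
      generalize loopStatus G u * x (u, 0) = e
      clear h1 hc h
      revert a0 b c d e; decide
  · intro h
    have h1 := h v
    rw [hc, hlv, y0, y1, y2, adj_self] at h1
    have h2 : x (v, 1) = c + x (v, 0) ∧ x (v, 2) = x (v, 0) + x (v, 1) := by
      generalize x (v, 0) = a0 at h1 ⊢
      generalize x (v, 1) = a1 at h1 ⊢
      generalize x (v, 2) = a2 at h1 ⊢
      clear hc h
      revert h1
      revert c a0 a1 a2; decide
    intro u
    by_cases hu : u = v
    · subst hu
      rw [hc, hlv, one_mul]
      exact h2
    · have h3 := h u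
      rw [yu u hu, yu u hu, yu u hu, h2.1] at h3
      refine ⟨?_, h3.2⟩
      rw [h3.1]
      generalize x (v, 0) = a0
      generalize adj G.toSimpleGraph v u = d
      generalize ∑ w, adj G.toSimpleGraph w u * x (w, 0) = b
      generalize loopStatus G u * x (u, 0) = e
      clear h1 h2 h3 hc h
      revert a0 b c d e; decide

theorem exists_twistedBy_of_toSimpleGraph_eq {G H K : LoopedGraph V}
    (h : H.toSimpleGraph = K.toSimpleGraph) (hG : ∃ s, TwistedBy s G H) :
    ∃ s, TwistedBy s G K := by
  obtain ⟨s, hs⟩ := hG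
  exact ⟨_, hs.trans (twistedBy_of_toSimpleGraph_eq h)⟩

theorem exists_twistedBy_nonsimpleComplement (G : LoopedGraph V) (v : V) :
    ∃ s, TwistedBy s G (G.nonsimpleComplement v) := by
  classical
  -- Looping every vertex first only exchanges some χ and ψ, and makes the looped case available at
  -- `v`.
  let G' : LoopedGraph V := ⟨G.toSimpleGraph, Set.univ⟩
  have h1 : TwistedBy _ G G' := twistedBy_of_toSimpleGraph_eq rfl
  have h2 := twistedBy_nonsimpleComplement (G := G') (v := v) (Set.mem_univ v)
  exact exists_twistedBy_of_toSimpleGraph_eq (H := G'.nonsimpleComplement v) rfl ⟨_, h1.trans h2⟩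

theorem LoopedGraph.LocallyEquivalent.exists_twistedBy
    {G H : LoopedGraph V} (h : G.LocallyEquivalent H) : ∃ s, TwistedBy s G H := by
  induction h with
  | refl => exact ⟨_, twistedBy_of_toSimpleGraph_eq rfl⟩
  | @tail K _ _ h ih =>
    obtain ⟨s, hs⟩ := ih
    obtain ⟨v, h⟩ := h
    obtain ⟨t, ht⟩ := exists_twistedBy_nonsimpleComplement K v
    obtain rfl | rfl | rfl := h
    · exact exists_twistedBy_of_toSimpleGraph_eq (H := K) rfl ⟨s, hs⟩
    · exact exists_twistedBy_of_toSimpleGraph_eq (H := K.nonsimpleComplement v) rfl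
        ⟨_, hs.trans ht⟩
    · exact ⟨_, hs.trans ht⟩

theorem LoopedGraph.locallyEquivalent_of_toSimpleGraph_eq {H : LoopedGraph V} (n : ℕ) :
    ∀ {G : LoopedGraph V}, G.toSimpleGraph = H.toSimpleGraph →
      (symmDiff G.loops H.loops).ncard = n → G.LocallyEquivalent H := by
  induction n with
  | zero =>
    intro G h hn
    rw [Set.ncard_eq_zero, ← Set.bot_eq_empty, symmDiff_eq_bot] at hn
    obtain ⟨_, _⟩ := G
    obtain ⟨_, _⟩ := H
    obtain rfl := h
    obtain rfl := hn
    exact Relation.ReflTransGen.refl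
  | succ n ih =>
    intro G h hn
    obtain ⟨v, hv⟩ : (symmDiff G.loops H.loops).Nonempty := by
      rw [← Set.ncard_pos]; omega
    have hstep : ∃ u, G.loopComplement v = G.loopComplement u ∨
        G.loopComplement v = G.simpleComplement u ∨
        G.loopComplement v = G.nonsimpleComplement u := ⟨v, .inl rfl⟩
    refine Relation.ReflTransGen.head hstep (ih (G := G.loopComplement v) h ?_)
    have : symmDiff (G.loopComplement v).loops H.loops = symmDiff G.loops H.loops \ {v} := by
      ext u
      simp only [LoopedGraph.loopComplement, Set.mem_symmDiff, Set.mem_sdiff,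
        Set.mem_singleton_iff] at hv ⊢
      by_cases hu : u = v
      · subst hu; tauto
      · tauto
    rw [this, Set.ncard_sdiff_singleton_of_mem hv, hn]
    rfl

/-- The vector of `G` with φ-part the unit vector at `u` shows the adjacency of `u` and `v` at both
`(v, 1)` and `(v, 2)`, so a remaining exchange of χ(v) and ψ(v) is invisible. -/
theorem TwistedBy.toSimpleGraph_eq {s : V → Equiv.Perm (Fin 3)} {G H : LoopedGraph V}
    (h : TwistedBy s G H) (hs : ∀ v, s v 0 = 0) : G.toSimpleGraph = H.toSimpleGraph := by
  classical
  refine ext_adj fun u v => ?_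
  by_cases huv : u = v
  · subst huv; simp
  obtain ⟨x, hx, hx0⟩ := exists_mem_isotropicSpace G (Pi.single u 1)
  have hxH := (h x).1 hx
  have hy0 : ∀ w, twist s x (w, 0) = (Pi.single u 1 : V → ZMod 2) w := fun w => by
    rw [← hx0, twist, hs]
  have h1 := (hx v).1
  have h2 := (hx v).2
  have h3 := (hxH v).1
  simp only [hx0, hy0] at h1 h2 h3
  simp [Pi.single_apply, Ne.symm huv] at h1 h2 h3
  have h4 : s v 1 = 1 ∨ s v 1 = 2 := by
    have : s v 1 ≠ 0 := fun e => by
      have := (s v).injective (e.trans (hs v).symm)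
      exact absurd this (by decide)
    generalize s v 1 = k at *
    revert k; decide
  rw [← h1, ← h3, twist]
  rcases h4 with h4 | h4
  · rw [h4]
  · rw [h4, h2]

theorem exists_twistedBy_loopComplement {s : V → Equiv.Perm (Fin 3)} {G H : LoopedGraph V}
    (h : TwistedBy s G H) (v : V) : ∃ s', TwistedBy s' (G.loopComplement v) H ∧
      (∀ w, w ≠ v → s' w = s w) ∧ s' v = Equiv.swap 1 2 * s v := by
  classical
  refine ⟨_, (twistedBy_loopComplement G v).symm.trans h, fun w hw => ?_, ?_⟩
  · simp [hw]
  · simp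

theorem exists_twistedBy_nonsimpleComplement_of_mem {s : V → Equiv.Perm (Fin 3)}
    {G H : LoopedGraph V} (h : TwistedBy s G H) {v : V} (hv : v ∈ G.loops) :
    ∃ s', TwistedBy s' (G.nonsimpleComplement v) H ∧
      (∀ w, w ≠ v → s' w = s w) ∧ s' v = Equiv.swap 0 1 * s v := by
  classical
  refine ⟨_, (twistedBy_nonsimpleComplement hv).symm.trans h, fun w hw => ?_, ?_⟩
  · simp [hw]
  · simp

/-- The hypothesis says that the column selected by `s v 0` has diagonal entry 1; local
complementation at `v` then restores φ(v), after a loop complementation in the ψ case. -/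
theorem TwistedBy.exists_fix {s : V → Equiv.Perm (Fin 3)} {G H : LoopedGraph V}
    (h : TwistedBy s G H) {v : V} (hv : (v ∈ G.loops ∧ s v 0 = 1) ∨ (v ∉ G.loops ∧ s v 0 = 2)) :
    ∃ G' s', G.LocallyEquivalent G' ∧ TwistedBy s' G' H ∧ (∀ w, w ≠ v → s' w = s w) ∧
      s' v 0 = 0 := by
  rcases hv with ⟨hv, hs⟩ | ⟨hv, hs⟩
  · obtain ⟨s', h1, h2, h3⟩ := exists_twistedBy_nonsimpleComplement_of_mem h hv
    exact ⟨_, s', G.locallyEquivalent_nonsimpleComplement v, h1, h2, by simp [h3, hs]⟩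
  · obtain ⟨s', h1, h2, h3⟩ := exists_twistedBy_loopComplement h v
    have hv' : v ∈ (G.loopComplement v).loops := by
      simp [LoopedGraph.loopComplement, Set.mem_symmDiff, hv]
    obtain ⟨s'', h4, h5, h6⟩ := exists_twistedBy_nonsimpleComplement_of_mem h1 hv'
    exact ⟨_, s'', (G.locallyEquivalent_loopComplement v).trans
      (LoopedGraph.locallyEquivalent_nonsimpleComplement _ v), h4,
      fun w hw => by rw [h5 w hw, h2 w hw], by simp [h6, h3, hs]⟩

/-- Here the selected column has diagonal entry 0. If `s` fixed φ at all neighbors of `v`, the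
vector of `H` with φ-part the unit vector at `v` would pull back to one vanishing on φ of these
neighbors, hence at the selected coordinate, where it must be 1. -/
theorem TwistedBy.exists_adj {s : V → Equiv.Perm (Fin 3)} {G H : LoopedGraph V}
    (h : TwistedBy s G H) {v : V} (hv : (v ∉ G.loops ∧ s v 0 = 1) ∨ (v ∈ G.loops ∧ s v 0 = 2)) :
    ∃ w, G.toSimpleGraph.Adj v w ∧ s w 0 ≠ 0 := by
  classical
  by_contra! hcon
  obtain ⟨y, hy, hy0⟩ := exists_mem_isotropicSpace H (Pi.single v 1)
  have hx := (h.symm y).1 hy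
  set x := twist s⁻¹ y with hxy
  have hyx : ∀ u, x (u, s u 0) = (Pi.single v 1 : V → ZMod 2) u := fun u => by
    rw [← hy0, ← twist_twist_inv s y]
    rfl
  have hsum : ∑ u, adj G.toSimpleGraph u v * x (u, 0) = 0 := by
    refine Finset.sum_eq_zero fun u _ => ?_
    by_cases ha : G.toSimpleGraph.Adj v u
    · have := hyx u
      rw [hcon u ha, Pi.single_eq_of_ne ha.ne.symm] at this
      rw [this, mul_zero]
    · rw [adj_comm, adj_eq_zero.2 ha, zero_mul]
  have h1 := (hx v).1
  have h2 := (hx v).2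
  rw [hsum, loopStatus] at h1
  have h3 := hyx v
  rw [Pi.single_eq_same] at h3
  rcases hv with ⟨hv, hs⟩ | ⟨hv, hs⟩
  · rw [hs] at h3
    simp [hv, h3] at h1
  · rw [hs] at h3
    simp only [hv, if_true, zero_add, one_mul] at h1
    rw [h1, zmod_two_add_self, h3] at h2
    exact one_ne_zero h2

theorem TwistedBy.locallyEquivalent {H : LoopedGraph V} (n : ℕ) :
    ∀ {s : V → Equiv.Perm (Fin 3)} {G : LoopedGraph V}, TwistedBy s G H →
      {v | s v 0 ≠ 0}.ncard = n → G.LocallyEquivalent H := by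
  induction n with
  | zero =>
    intro s G h hn
    rw [Set.ncard_eq_zero] at hn
    refine LoopedGraph.locallyEquivalent_of_toSimpleGraph_eq _ (h.toSimpleGraph_eq fun v => ?_) rfl
    by_contra hv
    exact Set.eq_empty_iff_forall_notMem.1 hn v hv
  | succ n ih =>
    intro s G h hn
    have finish : ∀ {s : V → Equiv.Perm (Fin 3)} {G : LoopedGraph V}, TwistedBy s G H →
        {v | s v 0 ≠ 0}.ncard = n + 1 → (∃ v, (v ∈ G.loops ∧ s v 0 = 1) ∨
          (v ∉ G.loops ∧ s v 0 = 2)) → G.LocallyEquivalent H := by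
      rintro s G h hn ⟨v, hv⟩
      obtain ⟨G', s', h1, h2, h3, h4⟩ := h.exists_fix hv
      refine h1.trans (ih h2 ?_)
      have hvs : v ∈ {v | s v 0 ≠ 0} := by
        rcases hv with ⟨-, hv⟩ | ⟨-, hv⟩ <;> simp [hv]
      have : {v | s' v 0 ≠ 0} = {v | s v 0 ≠ 0} \ {v} := by
        ext w
        by_cases hw : w = v
        · subst hw; simp [h4]
        · simp [h3 w hw, hw]
      rw [this, Set.ncard_sdiff_singleton_of_mem hvs, hn]
      rfl
    by_cases hex : ∃ v, (v ∈ G.loops ∧ s v 0 = 1) ∨ (v ∉ G.loops ∧ s v 0 = 2)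
    · exact finish h hn hex
    have hD : ∀ v, s v 0 ≠ 0 → (v ∉ G.loops ∧ s v 0 = 1) ∨ (v ∈ G.loops ∧ s v 0 = 2) := by
      intro v hv
      have h1 : s v 0 = 1 ∨ s v 0 = 2 := by
        generalize s v 0 = k at *
        revert k; decide
      have h2 := fun h => hex ⟨v, h⟩
      tauto
    obtain ⟨v, hv⟩ : {v | s v 0 ≠ 0}.Nonempty := by
      rw [← Set.ncard_pos]; omega
    obtain ⟨w, hvw, hw⟩ := h.exists_adj (hD v hv)
    -- Local complementation at `v` serves here to toggle the loop of `w`, which makes `w` fixable.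
    -- Having `v` looped with `s₁ v 0 = 2` keeps the count unchanged, since `swap 0 1` fixes 2.
    obtain ⟨G₁, s₁, e₁, h₁, hs₁, hg₁, hl₁, hv₁, hv₁'⟩ : ∃ (G₁ : LoopedGraph V) (s₁ : V → _),
        G.LocallyEquivalent G₁ ∧ TwistedBy s₁ G₁ H ∧ (∀ u, u ≠ v → s₁ u = s u) ∧
        G₁.toSimpleGraph = G.toSimpleGraph ∧ (w ∈ G₁.loops ↔ w ∈ G.loops) ∧ v ∈ G₁.loops ∧
        s₁ v 0 = 2 := by
      rcases hD v hv with ⟨h1, h2⟩ | ⟨h1, h2⟩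
      · obtain ⟨s', h3, h4, h5⟩ := exists_twistedBy_loopComplement h v
        refine ⟨_, s', G.locallyEquivalent_loopComplement v, h3, h4, rfl, ?_, ?_, by simp [h5, h2]⟩
        · simp [LoopedGraph.loopComplement, Set.mem_symmDiff, hvw.ne.symm]
        · simp [LoopedGraph.loopComplement, Set.mem_symmDiff, h1]
      · exact ⟨G, s, Relation.ReflTransGen.refl, h, fun _ _ => rfl, rfl, Iff.rfl, h1, h2⟩
    obtain ⟨s₂, h₂, hs₂, hv₂⟩ := exists_twistedBy_nonsimpleComplement_of_mem h₁ hv₁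
    have hv₂' : s₂ v 0 = 2 := by
      rw [hv₂, Equiv.Perm.mul_apply, hv₁', Equiv.swap_apply_of_ne_of_ne (by decide) (by decide)]
    have hs : ∀ u, u ≠ v → s₂ u = s u := fun u hu => (hs₂ u hu).trans (hs₁ u hu)
    refine e₁.trans ((G₁.locallyEquivalent_nonsimpleComplement v).trans (finish h₂ ?_ ⟨w, ?_⟩))
    · rw [← hn]
      congr 1
      ext u
      by_cases hu : u = v
      · subst hu; simpa [hv₂'] using hv
      · simp [hs u hu]
    · have h3 := hD w hw
      rw [hs w hvw.ne.symm]
      have : w ∈ (G₁.nonsimpleComplement v).loops ↔ w ∉ G.loops := by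
        simp [LoopedGraph.nonsimpleComplement, Set.mem_symmDiff, hg₁, hvw, hl₁]
      rw [this]
      tauto

end Twist

/-- The triples over `W`, pulled back along `f`, and those over `V` are two triple systems on `L`;
an automorphism of `L` aligning them corrects `f` to a map respecting triples. -/
theorem exists_fiberwise {V W : Type*} [Finite V] {L : Submodule (ZMod 2) (V × Fin 3 → ZMod 2)}
    {L' : Submodule (ZMod 2) (W × Fin 3 → ZMod 2)} (hL : IsTripleSystem Prod.fst L)
    (hL' : IsTripleSystem Prod.fst L') (h : Equivalent L L') :
    ∃ (e : V ≃ W) (t : V → Equiv.Perm (Fin 3)),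
      ∀ x : W × Fin 3 → ZMod 2, (fun a => x (e a.1, t a.1 a.2)) ∈ L ↔ x ∈ L' := by
  obtain ⟨f, hf⟩ := h
  obtain ⟨σ, hσ, hfib⟩ := exists_preserves_fibers_eq (hL'.comp_equiv f hf) _ hL rfl
  have key : ∀ a b : V × Fin 3, (f (σ.symm a)).1 = (f (σ.symm b)).1 ↔ a.1 = b.1 := fun a b => by
    have := hfib (σ.symm a) (σ.symm b)
    simpa using this.symm
  let g : V × Fin 3 ≃ W × Fin 3 := σ.symm.trans f
  have hg : ∀ a b, (g a).1 = (g b).1 ↔ a.1 = b.1 := key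
  let e : V ≃ W := Equiv.ofBijective (fun v => (g (v, 0)).1)
    ⟨fun v w h => (hg _ _).1 h, fun w => ⟨(g.symm (w, 0)).1, by
      have := (hg ((g.symm (w, 0)).1, 0) (g.symm (w, 0))).2 rfl
      simpa using this⟩⟩
  have he : ∀ v k, (g (v, k)).1 = e v := fun v k => (hg _ _).2 rfl
  let t : V → Equiv.Perm (Fin 3) := fun v => Equiv.ofBijective (fun k => (g (v, k)).2)
    (Finite.injective_iff_bijective.1 fun i j h => by
      have : g (v, i) = g (v, j) := Prod.ext (by rw [he, he]) h
      simpa using g.injective this)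
  refine ⟨e, t, fun x => ?_⟩
  have h1 : (fun a : V × Fin 3 => x (e a.1, t a.1 a.2)) = (x ∘ f) ∘ σ.symm := by
    funext a
    have : (e a.1, t a.1 a.2) = g a := Prod.ext (he a.1 a.2).symm rfl
    rw [this]
    rfl
  rw [h1, ← hσ, ← hf]
  simp [Function.comp_assoc]

/-! ### The symplectic form on isotropic spaces -/

section Duality

variable {V W : Type*} [Fintype V] [Fintype W]

/-- Maximality of the isotropic space: pairing with the vector whose φ-part is the unit vector at
`u` gives the equation at `u`. -/
theorem mem_isotropicSpace_of_orthogonal {G : LoopedGraph V} {y : V × Fin 3 → ZMod 2}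
    (hy : ∀ v, y (v, 2) = y (v, 0) + y (v, 1))
    (h : ∀ x ∈ isotropicSpace G, ∑ v, (x (v, 0) * y (v, 1) + x (v, 1) * y (v, 0)) = 0) :
    y ∈ isotropicSpace G := by
  classical
  intro u
  refine ⟨?_, hy u⟩
  obtain ⟨x, hx, hx0⟩ := exists_mem_isotropicSpace G (Pi.single u 1)
  have hx1 : ∀ v, x (v, 1) = adj G.toSimpleGraph u v + if v = u then loopStatus G u else 0 :=
    fun v => by
      rw [(hx v).1]
      simp only [hx0, Pi.single_apply]
      by_cases hvu : v = u
      · subst hvu; simp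
      · simp [hvu]
  have := h x hx
  simp only [hx0, hx1, Pi.single_apply, Finset.sum_add_distrib, add_mul, ite_mul, one_mul,
    zero_mul, Finset.sum_ite_eq', Finset.mem_univ, if_true, adj_comm _ u] at this
  generalize y (u, 1) = a at *
  generalize ∑ v, adj G.toSimpleGraph v u * y (v, 0) = b at *
  generalize loopStatus G u * y (u, 0) = c at *
  clear hx1
  revert a b c; decide

theorem sum_symplectic_eq_zero {G : LoopedGraph V} {x y : V × Fin 3 → ZMod 2}
    (hx : x ∈ isotropicSpace G) (hy : y ∈ isotropicSpace G) :
    ∑ v, (x (v, 0) * y (v, 1) + x (v, 1) * y (v, 0)) = 0 := by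
  have h1 : ∀ v, x (v, 0) * y (v, 1) = ∑ u, adj G.toSimpleGraph u v * x (v, 0) * y (u, 0) +
      loopStatus G v * x (v, 0) * y (v, 0) := fun v => by
    rw [(hy v).1, mul_add, Finset.mul_sum]
    congr 1
    · exact Finset.sum_congr rfl fun _ _ => by ring
    · ring
  have h2 : ∀ v, x (v, 1) * y (v, 0) = ∑ u, adj G.toSimpleGraph v u * x (u, 0) * y (v, 0) +
      loopStatus G v * x (v, 0) * y (v, 0) := fun v => by
    rw [(hx v).1, add_mul, Finset.sum_mul]
    congr 1
    exact Finset.sum_congr rfl fun u _ => by rw [adj_comm]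
  simp only [h1, h2, Finset.sum_add_distrib]
  rw [Finset.sum_comm (f := fun v u => adj G.toSimpleGraph u v * x (v, 0) * y (u, 0))]
  exact zmod_two_add_self _

theorem isSelfOrthogonal_isotropicSpace (G : LoopedGraph V) :
    IsSelfOrthogonal (isotropicSpace G) := by
  intro x hx y hy
  rw [Fintype.sum_prod_type, ← sum_symplectic_eq_zero hx hy]
  -- On even triples the dot product equals the symplectic pairing.
  refine Finset.sum_congr rfl fun v _ => ?_
  rw [Fin.sum_univ_three, (hx v).2, (hy v).2]
  generalize x (v, 0) = a
  generalize x (v, 1) = b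
  generalize y (v, 0) = c
  generalize y (v, 1) = d
  revert a b c d; decide

theorem isTripleSystem_isotropicSpace (G : LoopedGraph V) :
    IsTripleSystem Prod.fst (isotropicSpace G) where
  exists_fiber := by
    rintro ⟨v, k⟩
    obtain ⟨i, j, hi, hj, hij, h⟩ : ∃ i j : Fin 3, i ≠ k ∧ j ≠ k ∧ i ≠ j ∧
      ∀ l, l = k ∨ l = i ∨ l = j := by revert k; decide
    refine ⟨(v, i), (v, j), by simp [hi], by simp [hj], by simp [hij], ?_⟩
    rintro ⟨w, l⟩
    have := h l
    simp only [Prod.mk.injEq]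
    tauto
  even := by
    rintro x hx ⟨v, i⟩ ⟨w, j⟩ ⟨u, k⟩ h1 h2 h3 (rfl : w = v) (rfl : u = w)
    have h := (hx u).2
    simp only [ne_eq, Prod.mk.injEq, true_and] at h1 h2 h3
    have key : ∀ a b c : ZMod 2, c = a + b → ∀ i j k : Fin 3, i ≠ j → i ≠ k → j ≠ k →
        ![a, b, c] i + ![a, b, c] j + ![a, b, c] k = 0 := by decide
    have e : ∀ i, ![x (u, 0), x (u, 1), x (u, 2)] i = x (u, i) := fun i => by
      fin_cases i <;> rfl
    simpa only [e] using key _ _ _ h i j k h1 h2 h3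
  dual := by
    classical
    rintro ⟨a, i⟩ ⟨b, j⟩ ⟨c, k⟩ hab hac hbc h
    dsimp only at hab hac hbc
    set l : V × Fin 3 → ZMod 2 := fun y => _ with hl
    have la : ∀ m, l (a, m) = if m = i then 0 else 1 := fun m => by
      by_cases hm : m = i <;> simp [hl, hab, hac, hm]
    have lb : ∀ m, l (b, m) = if m = j then 0 else 1 := fun m => by
      by_cases hm : m = j <;> simp [hl, hab.symm, hbc, hm]
    have lc : ∀ m, l (c, m) = if m = k then 0 else 1 := fun m => by
      by_cases hm : m = k <;> simp [hl, hac.symm, hbc.symm, hm]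
    have lv : ∀ v, v ≠ a → v ≠ b → v ≠ c → ∀ m, l (v, m) = 0 := fun v h1 h2 h3 m => by
      simp [hl, h1, h2, h3]
    -- A triple with 0 at `n` and 1 elsewhere pairs with `x` to `x (v, n)`, so the pairing of `l`
    -- with `x` is the sum assumed to vanish.
    have key : ∀ (x : V × Fin 3 → ZMod 2) v, x (v, 2) = x (v, 0) + x (v, 1) → ∀ n : Fin 3,
        x (v, 0) * (if (1 : Fin 3) = n then 0 else 1) +
          x (v, 1) * (if (0 : Fin 3) = n then 0 else 1) = x (v, n) := by
      intro x v hx n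
      fin_cases n
      · simp
      · simp
      · simp [hx]
    refine mem_isotropicSpace_of_orthogonal (fun v => ?_) fun x hx => ?_
    · by_cases h1 : v = a
      · subst h1
        simp only [la]
        clear hl la lb lc lv h
        revert i; decide
      by_cases h2 : v = b
      · subst h2
        simp only [lb]
        clear hl la lb lc lv h
        revert j; decide
      by_cases h3 : v = c
      · subst h3
        simp only [lc]
        clear hl la lb lc lv h
        revert k; decide
      simp [lv v h1 h2 h3]
    · have : ∀ v, x (v, 0) * l (v, 1) + x (v, 1) * l (v, 0) =
          (if v = a then x (a, i) else 0) + (if v = b then x (b, j) else 0) +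
            (if v = c then x (c, k) else 0) := fun v => by
        by_cases h1 : v = a
        · subst h1
          simp only [la, key x _ (hx _).2, hab, hac, if_true, if_false, add_zero]
        by_cases h2 : v = b
        · subst h2
          simp only [lb, key x _ (hx _).2, hab.symm, hbc, if_true, if_false, add_zero, zero_add]
        by_cases h3 : v = c
        · subst h3
          simp only [lc, key x _ (hx _).2, hac.symm, hbc.symm, if_true, if_false, zero_add]
        simp [lv v h1 h2 h3, h1, h2, h3]
      simp only [this, Finset.sum_add_distrib, Finset.sum_ite_eq', Finset.mem_univ, if_true]
      exact h x hx

variable {α β γ : Type*}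

theorem Equivalent.symm {L : Submodule (ZMod 2) (α → ZMod 2)}
    {L' : Submodule (ZMod 2) (β → ZMod 2)} (h : Equivalent L L') : Equivalent L' L := by
  obtain ⟨f, hf⟩ := h
  refine ⟨f.symm, fun x => ?_⟩
  rw [← hf]
  simp [Function.comp_assoc]

theorem Equivalent.trans {L : Submodule (ZMod 2) (α → ZMod 2)}
    {L' : Submodule (ZMod 2) (β → ZMod 2)} {L'' : Submodule (ZMod 2) (γ → ZMod 2)}
    (h : Equivalent L L') (h' : Equivalent L' L'') : Equivalent L L'' := by
  obtain ⟨f, hf⟩ := h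
  obtain ⟨g, hg⟩ := h'
  refine ⟨f.trans g, fun x => ?_⟩
  rw [← hg, ← hf]
  rfl

theorem IsSelfOrthogonal.of_equivalent [Fintype α] [Fintype β]
    {L : Submodule (ZMod 2) (α → ZMod 2)} {L' : Submodule (ZMod 2) (β → ZMod 2)}
    (hL : IsSelfOrthogonal L) (h : Equivalent L L') : IsSelfOrthogonal L' := by
  obtain ⟨f, hf⟩ := h
  intro x hx y hy
  rw [← hL _ ((hf x).2 hx) _ ((hf y).2 hy)]
  exact (Fintype.sum_equiv f _ _ fun _ => rfl).symm

theorem TwistedBy.equivalent {s : V → Equiv.Perm (Fin 3)} {G H : LoopedGraph V}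
    (h : TwistedBy s G H) : Equivalent (isotropicSpace G) (isotropicSpace H) := by
  refine ⟨⟨fun a => (a.1, s⁻¹ a.1 a.2), fun a => (a.1, s a.1 a.2), fun a => by simp,
    fun a => by simp⟩, fun x => ?_⟩
  exact (h.symm x).symm

theorem LoopedGraph.IsIsomorphic.equivalent {G : LoopedGraph V} {H : LoopedGraph W}
    (h : G.IsIsomorphic H) : Equivalent (isotropicSpace G) (isotropicSpace H) := by
  obtain ⟨e, he⟩ := h
  refine ⟨e.toEquiv.prodCongr (Equiv.refl _), fun x => ?_⟩
  have hsum : ∀ v, ∑ u, adj G.toSimpleGraph u v * x (e u, 0) =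
      ∑ u, adj H.toSimpleGraph u (e v) * x (u, 0) := fun v =>
    Fintype.sum_equiv e.toEquiv _ _ fun u => by
      rw [adj_congr (e.map_adj_iff (v := u) (w := v)).symm]; rfl
  have hl : ∀ v, loopStatus G v = loopStatus H (e v) := fun v => by
    by_cases hv : v ∈ G.loops <;> simp [loopStatus, he v, hv]
  have hx : ∀ v k, (x ∘ e.toEquiv.prodCongr (Equiv.refl (Fin 3))) (v, k) = x (e v, k) :=
    fun _ _ => rfl
  simp only [mem_isotropicSpace, hx, hsum, hl]
  exact e.toEquiv.forall_congr_right (q := fun v =>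
    x (v, 1) = ∑ u, adj H.toSimpleGraph u v * x (u, 0) + loopStatus H v * x (v, 0) ∧
      x (v, 2) = x (v, 0) + x (v, 1))

theorem locallyEquivalentUpToIso_iff (G : LoopedGraph V) (H : LoopedGraph W) :
    G.LocallyEquivalentUpToIso H ↔ Equivalent (isotropicSpace G) (isotropicSpace H) := by
  constructor
  · rintro ⟨G', h, h'⟩
    obtain ⟨s, hs⟩ := h.exists_twistedBy
    exact hs.equivalent.trans h'.equivalent
  · intro h
    obtain ⟨e, t, h⟩ := exists_fiberwise (isTripleSystem_isotropicSpace G)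
      (isTripleSystem_isotropicSpace H) h
    -- Relabelling `H` by `V` absorbs `e` and leaves only the permutations `t` inside the triples.
    let H' : LoopedGraph V := ⟨H.toSimpleGraph.comap e, e ⁻¹' H.loops⟩
    let i : H'.toSimpleGraph ≃g H.toSimpleGraph := SimpleGraph.Iso.comap e H.toSimpleGraph
    have hsum : ∀ (x : V → ZMod 2) v, ∑ u, adj H'.toSimpleGraph u v * x u =
        ∑ u, adj H.toSimpleGraph u (e v) * x (e.symm u) := fun x v =>
      Fintype.sum_equiv e _ _ fun u => by
        rw [adj_congr (i.map_adj_iff (v := u) (w := v)).symm, e.symm_apply_apply]; rfl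
    have hl : ∀ v, loopStatus H' v = loopStatus H (e v) := fun v => rfl
    have hH : ∀ x : V × Fin 3 → ZMod 2, x ∈ isotropicSpace H' ↔
        (fun a : W × Fin 3 => x (e.symm a.1, a.2)) ∈ isotropicSpace H := fun x => by
      simp only [mem_isotropicSpace]
      rw [← e.forall_congr_right]
      simp only [e.symm_apply_apply, hl, hsum fun v => x (v, 0)]
    have htw : TwistedBy t H' G := fun x => by
      rw [hH, ← h]
      simp only [e.symm_apply_apply]
      rfl
    exact ⟨H', htw.symm.locallyEquivalent _ rfl, i, fun v => Iff.rfl⟩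

end Duality

/-! ### The fundamental graph and the row space of `IAS(G)` -/

section Fundamental

variable {V W : Type*}

open Classical in
theorem LoopedGraph.IAS_col_inl (G : LoopedGraph V) (v : V) :
    G.IAS.col (Sum.inl v) = Pi.single v 1 := by
  funext w
  change (1 : Matrix V V (ZMod 2)) w v = _
  simp [Matrix.one_apply, Pi.single_apply]

/-- φ(v) lies in the circuit exactly when it can be exchanged for `w`, that is, when column `w` is
not spanned by the other unit vectors. -/
theorem LoopedGraph.mem_fundCircuit_iff [Finite V] (G : LoopedGraph V) (v : V) (w : V ⊕ V) :
    Sum.inl v ∈ G.isotropicMatroid.fundCircuit (Sum.inr w) (Phi V) ↔ G.IAS v (Sum.inr w) = 1 := by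
  classical
  have := Fintype.ofFinite V
  have hB := G.isBase_Phi
  have hw : (Sum.inr w : V ⊕ V ⊕ V) ∉ Phi V := by simp [Phi]
  have hv : (Sum.inl v : V ⊕ V ⊕ V) ∈ Phi V := ⟨v, rfl⟩
  rw [hB.indep.mem_fundCircuit_iff (by rw [hB.closure_eq]; exact Set.mem_univ _) hw,
    ← Set.insert_sdiff_singleton_comm (by simp)]
  change LinearIndepOn (ZMod 2) G.IAS.col _ ↔ _
  rw [linearIndepOn_insert (by simp [Phi]), and_iff_right]
  swap
  · exact LinearIndepOn.mono (show LinearIndepOn (ZMod 2) G.IAS.col (Phi V) from hB.indep)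
      Set.sdiff_subset
  have hcol : G.IAS.col (Sum.inr w) = ∑ u, G.IAS u (Sum.inr w) • G.IAS.col (Sum.inl u) := by
    funext u
    rw [Finset.sum_apply]
    simp only [IAS_col_inl, Pi.smul_apply, Pi.single_apply, smul_eq_mul, mul_ite, mul_one,
      mul_zero, Finset.sum_ite_eq, Finset.mem_univ, if_true]
    rfl
  constructor
  · intro h
    by_contra hne
    have h0 := (zmod_two_eq_zero_or_one (G.IAS v (Sum.inr w))).resolve_right hne
    refine h ?_
    rw [hcol]
    refine sum_mem fun u _ => ?_
    by_cases hu : u = v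
    · rw [hu, h0, zero_smul]
      exact zero_mem _
    · exact Submodule.smul_mem _ _ (Submodule.subset_span ⟨Sum.inl u, by simp [Phi, hu], rfl⟩)
  · intro h hmem
    have hle : Submodule.span (ZMod 2) (G.IAS.col '' (Phi V \ {Sum.inl v})) ≤
        LinearMap.ker (LinearMap.proj v : (V → ZMod 2) →ₗ[ZMod 2] ZMod 2) := by
      rw [Submodule.span_le]
      rintro _ ⟨_, ⟨⟨u, rfl⟩, hu⟩, rfl⟩
      have hu' : u ≠ v := by simpa using hu
      simp [IAS_col_inl, hu'.symm]
    have := hle hmem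
    rw [LinearMap.mem_ker, LinearMap.proj_apply] at this
    change G.IAS v (Sum.inr w) = 0 at this
    rw [h] at this
    exact one_ne_zero this

/-- The elements of the isotropic matroid, indexed by a vertex and one of three types. -/
def LoopedGraph.element [Finite V] (G : LoopedGraph V) : V × Fin 3 ≃ G.isotropicMatroid.E :=
  Equiv.trans
    { toFun := fun a => ![Sum.inl a.1, Sum.inr (Sum.inl a.1), Sum.inr (Sum.inr a.1)] a.2
      invFun := Sum.elim (fun v => (v, 0)) (Sum.elim (fun v => (v, 1)) fun v => (v, 2))
      left_inv := by
        rintro ⟨v, k⟩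
        fin_cases k <;> rfl
      right_inv := by
        rintro (v | v | v) <;> rfl }
    (Equiv.subtypeUnivEquiv fun x : V ⊕ V ⊕ V =>
      (Set.mem_univ x : x ∈ G.isotropicMatroid.E)).symm

/-- The basis `Φ(G)` as a set of vertices of `B(G)`. -/
def LoopedGraph.basisVertices [Finite V] (G : LoopedGraph V) : Set G.isotropicMatroid.E :=
  {x | (x : V ⊕ V ⊕ V) ∈ Phi V}

theorem LoopedGraph.isBipartition_fundamentalBipartite [Finite V] (G : LoopedGraph V) :
    IsBipartition G.fundamentalBipartite G.basisVertices := by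
  intro x y h
  change (_ ∧ _ ∧ _) ∨ (_ ∧ _ ∧ _) at h
  change (x : V ⊕ V ⊕ V) ∈ Phi V ↔ (y : V ⊕ V ⊕ V) ∉ Phi V
  tauto

theorem LoopedGraph.element_mem_basisVertices [Finite V] (G : LoopedGraph V) (v : V)
    (k : Fin 3) : G.element (v, k) ∈ G.basisVertices ↔ k = 0 := by
  change ![Sum.inl v, Sum.inr (Sum.inl v), Sum.inr (Sum.inr v)] k ∈ Phi V ↔ _
  fin_cases k <;> simp [Phi]

theorem LoopedGraph.adj_element [Finite V] (G : LoopedGraph V) (u v : V) (w : V ⊕ V) (k : Fin 3)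
    (hk : (G.element (v, k) : V ⊕ V ⊕ V) = Sum.inr w) :
    adj G.fundamentalBipartite (G.element (u, 0)) (G.element (v, k)) = G.IAS u (Sum.inr w) := by
  have h : G.fundamentalBipartite.Adj (G.element (u, 0)) (G.element (v, k)) ↔
      G.IAS u (Sum.inr w) = 1 := by
    rw [← G.mem_fundCircuit_iff, ← hk]
    have h0 : (G.element (u, 0) : V ⊕ V ⊕ V) = Sum.inl u := rfl
    have h1 : (G.element (u, 0) : V ⊕ V ⊕ V) ∈ Phi V := ⟨u, rfl⟩
    have h2 : (G.element (v, k) : V ⊕ V ⊕ V) ∉ Phi V := by rw [hk]; simp [Phi]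
    change ((_ ∧ _ ∧ _) ∨ (_ ∧ _ ∧ _)) ↔ _
    rw [← h0]
    exact ⟨fun h => h.elim (fun h => h.2.2) fun h => absurd h.1 h2, fun h => .inl ⟨h1, h2, h⟩⟩
  rcases zmod_two_eq_zero_or_one (G.IAS u (Sum.inr w)) with h' | h'
  · rw [h', adj_eq_zero, h, h']; exact zero_ne_one
  · rw [h', adj_eq_one, h, h']

theorem LoopedGraph.adjacency_apply (G : LoopedGraph V) [DecidableEq V] (u v : V) :
    G.adjacency u v = adj G.toSimpleGraph u v + if u = v then loopStatus G v else 0 := by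
  by_cases huv : u = v
  · subst huv
    by_cases h : u ∈ G.loops <;> simp [adjacency, loopStatus, h]
  · by_cases h : G.Adj u v <;> simp [adjacency, adj, huv, h]

variable [Fintype V]

/-- The equations of `B(G)` at χ(v) and ψ(v) come from the columns of `A` and `A + I`; their
difference is evenness on the triple of `v`. -/
theorem LoopedGraph.mem_rowSpace_fundamentalBipartite (G : LoopedGraph V)
    [Fintype G.isotropicMatroid.E] (x : G.isotropicMatroid.E → ZMod 2) :
    x ∘ G.element ∈ isotropicSpace G ↔
      x ∈ rowSpace G.fundamentalBipartite G.basisVertices := by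
  classical
  have hsum : ∀ v k, k ≠ 0 → ∑ b, adj G.fundamentalBipartite b (G.element (v, k)) * x b =
      ∑ u, adj G.fundamentalBipartite (G.element (u, 0)) (G.element (v, k)) *
        x (G.element (u, 0)) := fun v k hk => by
    rw [← Fintype.sum_equiv G.element (fun a =>
      adj G.fundamentalBipartite (G.element a) (G.element (v, k)) * x (G.element a)) _
      fun _ => rfl, Fintype.sum_prod_type]
    refine Finset.sum_congr rfl fun u _ => ?_
    rw [Finset.sum_eq_single 0]
    · intro j _ hj
      rw [G.isBipartition_fundamentalBipartite.adj_eq_zero, zero_mul]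
      simp [element_mem_basisVertices, hj, hk]
    · simp
  have h1 : ∀ v, ∑ b, adj G.fundamentalBipartite b (G.element (v, 1)) * x b =
      ∑ u, adj G.toSimpleGraph u v * x (G.element (u, 0)) +
        loopStatus G v * x (G.element (v, 0)) := fun v => by
    have : ∀ u, adj G.fundamentalBipartite (G.element (u, 0)) (G.element (v, 1)) =
        adj G.toSimpleGraph u v + if u = v then loopStatus G v else 0 := fun u => by
      rw [G.adj_element u v (Sum.inl v) 1 rfl, ← G.adjacency_apply]
      rfl
    simp only [hsum v 1 one_ne_zero, this, add_mul, Finset.sum_add_distrib, ite_mul, zero_mul,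
      Finset.sum_ite_eq', Finset.mem_univ, if_true]
  have h2 : ∀ v, ∑ b, adj G.fundamentalBipartite b (G.element (v, 2)) * x b =
      x (G.element (v, 0)) + (∑ u, adj G.toSimpleGraph u v * x (G.element (u, 0)) +
        loopStatus G v * x (G.element (v, 0))) := fun v => by
    have : ∀ u, adj G.fundamentalBipartite (G.element (u, 0)) (G.element (v, 2)) =
        (if u = v then 1 else 0) +
          (adj G.toSimpleGraph u v + if u = v then loopStatus G v else 0) := fun u => by
      rw [G.adj_element u v (Sum.inr v) 2 rfl, ← G.adjacency_apply, add_comm]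
      change (G.adjacency + 1) u v = _
      rw [Matrix.add_apply, Matrix.one_apply]
    simp only [hsum v 2 (by decide), this, add_mul, Finset.sum_add_distrib, ite_mul, zero_mul,
      one_mul, Finset.sum_ite_eq', Finset.mem_univ, if_true]
  rw [mem_rowSpace, mem_isotropicSpace, ← G.element.forall_congr_right]
  simp only [Function.comp_apply]
  constructor
  · rintro h ⟨v, k⟩ hk
    rw [G.element_mem_basisVertices] at hk
    have hk' : k = 1 ∨ k = 2 := by revert k; decide
    rcases hk' with rfl | rfl
    · rw [h1]; exact (h v).1
    · rw [h2, (h v).2, ← (h v).1]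
  · intro h v
    have e1 := h (v, 1) (by simp [G.element_mem_basisVertices])
    have e2 := h (v, 2) (by simp [G.element_mem_basisVertices])
    rw [h1] at e1
    rw [h2, ← e1] at e2
    exact ⟨e1, e2⟩

end Fundamental

end IsotropicMatroid

theorem mainTheorem7 {V W : Type*} [Finite V] [Finite W]
    (G : IsotropicMatroid.LoopedGraph V) (H : IsotropicMatroid.LoopedGraph W) :
    G.LocallyEquivalentUpToIso H ↔
      IsotropicMatroid.PivotEquivalentUpToIso G.fundamentalBipartite H.fundamentalBipartite := by
  have := Fintype.ofFinite V
  have := Fintype.ofFinite W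
  have := Fintype.ofFinite G.isotropicMatroid.E
  have := Fintype.ofFinite H.isotropicMatroid.E
  have hG : IsotropicMatroid.Equivalent (IsotropicMatroid.isotropicSpace G)
      (IsotropicMatroid.rowSpace G.fundamentalBipartite G.basisVertices) :=
    ⟨G.element, G.mem_rowSpace_fundamentalBipartite⟩
  have hH : IsotropicMatroid.Equivalent (IsotropicMatroid.isotropicSpace H)
      (IsotropicMatroid.rowSpace H.fundamentalBipartite H.basisVertices) :=
    ⟨H.element, H.mem_rowSpace_fundamentalBipartite⟩
  have bG := G.isBipartition_fundamentalBipartite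
  have bH := H.isBipartition_fundamentalBipartite
  rw [IsotropicMatroid.locallyEquivalentUpToIso_iff]
  constructor
  · intro h
    exact (hG.symm.trans (h.trans hH)).pivotEquivalentUpToIso bG bH
  · intro h
    exact hG.trans ((h.equivalent bG bH
      ((IsotropicMatroid.isSelfOrthogonal_isotropicSpace G).of_equivalent hG)
      ((IsotropicMatroid.isSelfOrthogonal_isotropicSpace H).of_equivalent hH)).trans hH.symm)
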